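/- A simple digraph is a finite non-empty directed graph without loops that has at most one edge from $x$ to $y$ for every ordered pair $(x,y)$ of distinct vertices (edges in both directions between two vertices are allowed). It is Eulerian if every vertex has equal in-degree and out-degree. A digraph $D$ immerses a digraph $H$ if there are an injection $f : V(H) \to V(D)$ and pairwise edge-disjoint directed paths $P_{uv}$ in $D$, one for each edge $uv$ of $H$, such that $P_{uv}$ starts at $f(u)$ and ends at $f(v)$. Theorem 4.1. There exists a constant $\beta > 0$ such that for every large enough integer $k$ the following holds: every simple Eulerian digraph with minimum in-degree and minimum out-degree at least $100k$ immerses a simple digraph with at most $\beta k$ vertices and at least $k^2/2$ edges. -/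

import Mathlib

/-!
A simple digraph is a `Digraph` (at most one edge from `u` to `v` for each ordered pair `(u, v)`,
both directions allowed) without loops.
-/

namespace Digraph

variable {V W : Type*}

/-- No edge joins a vertex to itself. -/
def Loopless (G : Digraph V) : Prop := ∀ v, ¬ G.Adj v v

/-- The set of edges, as ordered pairs. -/
def edgeSet (G : Digraph V) : Set (V × V) := {e | G.Adj e.1 e.2}

/-- The number of in-neighbours of `v` (meaningful on a finite vertex type). -/
noncomputable def inDegree (G : Digraph V) (v : V) : ℕ := {u | G.Adj u v}.ncard

/-- The number of out-neighbours of `v` (meaningful on a finite vertex type). -/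
noncomputable def outDegree (G : Digraph V) (v : V) : ℕ := {w | G.Adj v w}.ncard

/-- Every vertex has equal in-degree and out-degree (connectedness is not required). -/
def IsEulerian (G : Digraph V) : Prop := ∀ v, G.inDegree v = G.outDegree v

/-- The list of vertices `l` is a directed path of `G` from `u` to `v`: consecutive vertices are
joined by edges of `G`, and no vertex is repeated. -/
structure IsDirectedPath (G : Digraph V) (u v : V) (l : List V) : Prop where
  chain : l.IsChain G.Adj
  nodup : l.Nodup
  start : l.head? = some u
  finish : l.getLast? = some v

/-- The consecutive pairs of a list of vertices: the edges traversed by a path. -/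
def pathEdges (l : List V) : List (V × V) := l.zip l.tail

/-- `G` immerses `H`: there are an injection `f` of the vertices of `H` into those of `G` and, for
every edge `uv` of `H`, a directed path of `G` from `f u` to `f v`, such that the paths of distinct
edges share no edge. (This is the usual notion for digraphs without loops.) -/
def Immerses (G : Digraph V) (H : Digraph W) : Prop :=
  ∃ (f : W → V) (P : W × W → List V),
    Function.Injective f ∧
    (∀ e ∈ H.edgeSet, G.IsDirectedPath (f e.1) (f e.2) (P e)) ∧
    (∀ e ∈ H.edgeSet, ∀ e' ∈ H.edgeSet, e ≠ e' →
      List.Disjoint (pathEdges (P e)) (pathEdges (P e')))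

end Digraph

/-! Replacing edges u → x → w by u → w preserves `IsRouted`: the edges of a multigraph are realised
by edge-disjoint connections in the digraph. A routed multigraph with many adjacent pairs on few
vertices therefore gives the immersion. Let L be about k / 10^11, d = 10^13 L, K = 10^10 L, and
suppose that every routed multigraph is locally sparse: at most 10^50 L vertices always span fewer
than 2 * 10^22 L^2 adjacent pairs.

Splitting at vertices of degree above d yields a routed simple d-regular digraph; a vertex where no
splitting is possible would have a dense neighbourhood (`exists_regular_isRouted`). Vertices are
then deleted one at a time, in-edges being joined to out-edges by a transport matrix of least price.
The `potential`, which charges for parallel edges and missing degrees, is kept at most K per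
remaining vertex. Once at most 10^50 L vertices remain, this forces about d edges per vertex with
few repetitions, hence d^2 / 4 adjacent pairs (`IsStage.le_card_edges`), a contradiction.

Deletion is controlled by an exchange argument. If v has few shortcuts (pairs x → v → w with x → w
present), then either its bundles weigh at least 3K more than the price of rerouting, or rerouting
creates no loop and costs little beyond a small fraction of that weight
(`IsOptimalTransport.cost_dichotomy`). Local sparsity leaves few vertices with many shortcuts
(`card_many_shortcuts_le`). Averaging then finds a vertex whose deletion preserves the bound
(`IsStage.exists_reduction`). -/

/-! ### Transport matrices -/

section Transport

open Finset

variable {X Y : Type*} [Fintype X] [Fintype Y]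

/-- `p` is a matrix of natural numbers with row sums `a` and column sums `b`. -/
structure IsTransport (a : X → ℕ) (b : Y → ℕ) (p : X → Y → ℕ) : Prop where
  row : ∀ x, ∑ y, p x y = a x
  col : ∀ y, ∑ x, p x y = b y

/-- The total cost of a matrix, where `c x y n` is the price of an entry `n` at `(x, y)`. -/
def transportCost (c : X → Y → ℕ → ℕ) (p : X → Y → ℕ) : ℕ := ∑ x, ∑ y, c x y (p x y)

theorem exists_isTransport (a : X → ℕ) (b : Y → ℕ) (h : ∑ x, a x = ∑ y, b y) :
    ∃ p, IsTransport a b p := by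
  classical
  induction n : ∑ x, a x generalizing a b with
  | zero =>
    refine ⟨fun _ _ => 0, ⟨fun x => ?_, fun y => ?_⟩⟩
    · have := (Finset.sum_eq_zero_iff.1 n) x (mem_univ _); simp [this]
    · have := (Finset.sum_eq_zero_iff.1 (h ▸ n)) y (mem_univ _); simp [this]
  | succ n ih =>
    obtain ⟨x, -, hx⟩ := Finset.exists_ne_zero_of_sum_ne_zero (s := univ) (f := a) (by omega)
    obtain ⟨y, -, hy⟩ := Finset.exists_ne_zero_of_sum_ne_zero (s := univ) (f := b) (by omega)
    have ha : a = fun i => (a i - if i = x then 1 else 0) + if i = x then 1 else 0 := by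
      funext i; by_cases hi : i = x <;> simp [hi]; omega
    have hb : b = fun i => (b i - if i = y then 1 else 0) + if i = y then 1 else 0 := by
      funext i; by_cases hi : i = y <;> simp [hi]; omega
    have sa : ∑ i, (a i - if i = x then 1 else 0) + 1 = ∑ i, a i := by
      conv_rhs => rw [ha]
      rw [sum_add_distrib]; simp
    have sb : ∑ i, (b i - if i = y then 1 else 0) + 1 = ∑ i, b i := by
      conv_rhs => rw [hb]
      rw [sum_add_distrib]; simp
    obtain ⟨p, hp⟩ := ih (fun i => a i - if i = x then 1 else 0)
      (fun i => b i - if i = y then 1 else 0) (by omega) (by omega)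
    refine ⟨fun i j => p i j + if i = x ∧ j = y then 1 else 0, ⟨fun i => ?_, fun j => ?_⟩⟩
    · rw [sum_add_distrib, hp.row]
      conv_rhs => rw [ha]
      by_cases hi : i = x <;> simp [hi]
    · rw [sum_add_distrib, hp.col]
      conv_rhs => rw [hb]
      by_cases hi : j = y <;> simp [hi]

theorem IsTransport.le_row {a : X → ℕ} {b : Y → ℕ} {p : X → Y → ℕ} (hp : IsTransport a b p)
    (x : X) (y : Y) : p x y ≤ a x := by
  rw [← hp.row]; exact single_le_sum (f := fun y => p x y) (fun _ _ => Nat.zero_le _) (mem_univ y)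

theorem IsTransport.le_col {a : X → ℕ} {b : Y → ℕ} {p : X → Y → ℕ} (hp : IsTransport a b p)
    (x : X) (y : Y) : p x y ≤ b y := by
  rw [← hp.col]; exact single_le_sum (f := fun x => p x y) (fun _ _ => Nat.zero_le _) (mem_univ x)

theorem IsTransport.transpose {a : X → ℕ} {b : Y → ℕ} {p : X → Y → ℕ} (hp : IsTransport a b p) :
    IsTransport b a (fun y x => p x y) := ⟨hp.col, hp.row⟩

open Classical in
/-- Exchange the columns of one unit at `(x, y)` and one unit at `(x', y')`. -/
noncomputable def swapEntries (p : X → Y → ℕ) (x x' : X) (y y' : Y) : X → Y → ℕ := fun i j =>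
  if i = x ∧ j = y then p x y - 1 else if i = x' ∧ j = y' then p x' y' - 1 else
  if i = x ∧ j = y' then p x y' + 1 else if i = x' ∧ j = y then p x' y + 1 else p i j

theorem IsTransport.swapEntries {a : X → ℕ} {b : Y → ℕ} {p : X → Y → ℕ} (hp : IsTransport a b p)
    {x x' : X} {y y' : Y} (hx : x ≠ x') (hy : y ≠ y') (h : 1 ≤ p x y) (h' : 1 ≤ p x' y') :
    IsTransport a b (swapEntries p x x' y y') := by
  classical
  have key : ∀ i j, _root_.swapEntries p x x' y y' i j
      + ((if i = x ∧ j = y then 1 else 0) + if i = x' ∧ j = y' then 1 else 0) =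
      p i j + ((if i = x ∧ j = y' then 1 else 0) + if i = x' ∧ j = y then 1 else 0) := by
    intro i j
    unfold _root_.swapEntries
    by_cases h1 : i = x <;> by_cases h2 : i = x' <;> by_cases h3 : j = y <;>
      by_cases h4 : j = y' <;> simp_all
  constructor
  · intro i
    have := Finset.sum_congr (rfl : (univ : Finset Y) = univ) (fun j _ => key i j)
    simp only [sum_add_distrib, hp.row] at this
    by_cases h1 : i = x <;> by_cases h2 : i = x' <;> simp_all
  · intro j
    have := Finset.sum_congr (rfl : (univ : Finset X) = univ) (fun i _ => key i j)
    simp only [sum_add_distrib, hp.col] at this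
    by_cases h1 : j = y <;> by_cases h2 : j = y' <;> simp_all

/-- Only four entries change, so optimality of a transport becomes an inequality between eight
prices. It is stated additively to avoid truncated subtraction. -/
theorem transportCost_swapEntries (c : X → Y → ℕ → ℕ) (p : X → Y → ℕ)
    {x x' : X} {y y' : Y} (hx : x ≠ x') (hy : y ≠ y') :
    transportCost c (swapEntries p x x' y y') +
      (c x y (p x y) + c x' y' (p x' y') + c x y' (p x y') + c x' y (p x' y)) =
    transportCost c p + (c x y (p x y - 1) + c x' y' (p x' y' - 1) +
      c x y' (p x y' + 1) + c x' y (p x' y + 1)) := by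
  classical
  unfold transportCost
  rw [← Fintype.sum_prod_type' (f := fun i j => c i j (swapEntries p x x' y y' i j)),
    ← Fintype.sum_prod_type' (f := fun i j => c i j (p i j))]
  set T : Finset (X × Y) := {(x, y), (x', y'), (x, y'), (x', y)} with hT
  rw [← sum_add_sum_compl T, ← sum_add_sum_compl T (fun q => c q.1 q.2 (p q.1 q.2))]
  have e : ∑ q ∈ Tᶜ, c q.1 q.2 (swapEntries p x x' y y' q.1 q.2) =
      ∑ q ∈ Tᶜ, c q.1 q.2 (p q.1 q.2) := by
    refine sum_congr rfl fun q hq => ?_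
    obtain ⟨i, j⟩ := q
    simp only [hT, mem_compl, mem_insert, mem_singleton, Prod.mk.injEq, not_or] at hq
    unfold swapEntries
    simp only [if_neg hq.1, if_neg hq.2.1, if_neg hq.2.2.1, if_neg hq.2.2.2]
  rw [e, hT]
  have n1 : (x, y) ∉ ({(x', y'), (x, y'), (x', y)} : Finset (X × Y)) := by simp [hx, hy]
  have n2 : (x', y') ∉ ({(x, y'), (x', y)} : Finset (X × Y)) := by simp [hx.symm, hy.symm]
  have n3 : (x, y') ∉ ({(x', y)} : Finset (X × Y)) := by simp [hx]
  simp only [sum_insert n1, sum_insert n2, sum_insert n3, sum_singleton]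
  simp only [swapEntries, hx, hx.symm, hy, hy.symm, and_self, and_false, false_and, if_true,
    if_false]
  ring

/-- If every unit of the matrix off row `x` and column `y` lies in a column of `R` or a row of `C`,
then the weights of `R` and `C` cover the total. -/
theorem IsTransport.sum_le_of_cover {a : X → ℕ} {b : Y → ℕ} {p : X → Y → ℕ}
    (hp : IsTransport a b p) {x : X} {y : Y} {R : Y → Prop} {C : X → Prop}
    [DecidablePred R] [DecidablePred C] (hR : R y) (hC : C x)
    (h : ∀ x' y', 1 ≤ p x' y' → x ≠ x' → y ≠ y' → R y' ∨ C x') :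
    ∑ y, b y ≤ (∑ y with R y, b y) + ∑ x with C x, a x := by
  classical
  have e1 : ∑ y with R y, b y = ∑ i, ∑ j, if R j then p i j else 0 := by
    rw [sum_comm, sum_filter]
    refine sum_congr rfl fun j _ => ?_
    split_ifs <;> simp [hp.col]
  have e2 : ∑ x with C x, a x = ∑ i, ∑ j, if C i then p i j else 0 := by
    rw [sum_filter]
    refine sum_congr rfl fun j _ => ?_
    split_ifs <;> simp [hp.row]
  have e3 : ∑ y, b y = ∑ i, ∑ j, p i j := by
    rw [sum_comm]; exact sum_congr rfl fun j _ => (hp.col j).symm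
  rw [e1, e2, e3, ← sum_add_distrib]
  refine sum_le_sum fun i _ => ?_
  rw [← sum_add_distrib]
  refine sum_le_sum fun j _ => ?_
  by_cases h0 : p i j = 0
  · simp [h0]
  by_cases hi : x = i
  · subst hi; simp [hC]
  by_cases hj : y = j
  · subst hj; simp [hR]
  rcases h i j (by omega) hi hj with h | h <;> simp [h]

end Transport

/-! ### The price of inserting a transport matrix into a multigraph -/

/-- The weight of a bundle of `n` parallel edges. -/
def bundleWeight (n : ℕ) : ℕ := (n - 1) + 99 * (n - 200)

section InsertionCost

open Finset
open scoped Classical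

variable {V : Type*}

/-- The price of adding `n` parallel edges from `x` to `y`; loops are deleted at price `100`. -/
noncomputable def insertionCost (M : V → V → ℕ) (x y : V) (n : ℕ) : ℕ :=
  if x = y then 100 * n else bundleWeight (M x y + n) - bundleWeight (M x y)

/-- The number of loops at `x` counted by an entry `n` at `(x, y)`. -/
noncomputable def loopCount (x y : V) (n : ℕ) : ℕ := if x = y then n else 0

theorem insertionCost_add_le (M : V → V → ℕ) (x y : V) (n k : ℕ) :
    insertionCost M x y (n + k) ≤ insertionCost M x y n + 100 * k := by
  unfold insertionCost bundleWeight; split_ifs <;> omega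

theorem insertionCost_le (M : V → V → ℕ) (x y : V) (n : ℕ) :
    insertionCost M x y n ≤ 100 * n := by
  unfold insertionCost bundleWeight; split_ifs <;> omega

theorem insertionCost_pred_le (M : V → V → ℕ) (x y : V) (n : ℕ) :
    insertionCost M x y (n - 1) ≤ insertionCost M x y n := by
  unfold insertionCost bundleWeight; split_ifs <;> omega

theorem insertionCost_pred_of_expensive {M : V → V → ℕ} {x y : V} {n : ℕ} (hn : 1 ≤ n)
    (h : x = y ∨ 200 < M x y + n) :
    insertionCost M x y (n - 1) + 100 = insertionCost M x y n := by
  unfold insertionCost bundleWeight; split_ifs <;> grind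

theorem insertionCost_pred_of_costly {M : V → V → ℕ} {x y : V} {n : ℕ} (hn : 1 ≤ n)
    (h : x = y ∨ 2 ≤ M x y + n) :
    insertionCost M x y (n - 1) + 1 ≤ insertionCost M x y n := by
  unfold insertionCost bundleWeight; split_ifs <;> grind

theorem insertionCost_succ_of_cheap {M : V → V → ℕ} {x y : V} {n : ℕ}
    (h : x ≠ y) (h' : M x y + n < 200) :
    insertionCost M x y (n + 1) ≤ insertionCost M x y n + 1 := by
  rw [insertionCost, if_neg h]; try rw [insertionCost, if_neg h]
  unfold bundleWeight; omega

theorem insertionCost_succ_of_free {M : V → V → ℕ} {x y : V} {n : ℕ}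
    (h : x ≠ y) (h' : M x y + n = 0) :
    insertionCost M x y (n + 1) = insertionCost M x y n := by
  rw [insertionCost, if_neg h]; try rw [insertionCost, if_neg h]
  unfold bundleWeight; omega

theorem insertionCost_le_self {M : V → V → ℕ} {x y : V} {n : ℕ}
    (h : x ≠ y) (h' : M x y + n ≤ 200) : insertionCost M x y n ≤ n := by
  rw [insertionCost, if_neg h]; try rw [insertionCost, if_neg h]
  unfold bundleWeight; omega

theorem insertionCost_eq_zero {M : V → V → ℕ} {x y : V} {n : ℕ}
    (h : 1 ≤ n → x ≠ y ∧ M x y + n ≤ 1) : insertionCost M x y n = 0 := by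
  unfold insertionCost bundleWeight; split_ifs <;> grind

theorem insertionCost_transpose (M : V → V → ℕ) (x y : V) (n : ℕ) :
    insertionCost (fun i j => M j i) x y n = insertionCost M y x n := by
  unfold insertionCost; simp [eq_comm]

variable [Fintype V]

/-- `∑ (a x - 1)`. -/
def excess (a : V → ℕ) : ℕ := ∑ x, (a x - 1)

/-- `∑ (a x - 200)`. -/
def surplus (a : V → ℕ) : ℕ := ∑ x, (a x - 200)

theorem surplus_le_excess (a : V → ℕ) : surplus a ≤ excess a :=
  sum_le_sum fun x _ => by omega

theorem sum_bundleWeight (a : V → ℕ) :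
    ∑ x, bundleWeight (a x) = excess a + 99 * surplus a := by
  rw [excess, surplus, mul_sum, ← sum_add_distrib]; rfl

theorem sum_min_add_surplus (a : V → ℕ) : ∑ x, min (a x) 200 + surplus a = ∑ x, a x := by
  rw [surplus, ← sum_add_distrib]; exact sum_congr rfl fun x _ => by omega

theorem sum_filter_le_card_add_excess (a : V → ℕ) (R : V → Prop)
    [DecidablePred R] :
    ∑ x with R x, a x ≤ #{x | R x ∧ 1 ≤ a x} + excess a := by
  rw [card_filter, sum_filter, excess, ← sum_add_distrib]
  refine sum_le_sum fun x _ => ?_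
  by_cases h1 : R x <;> by_cases h2 : 1 ≤ a x <;> simp [h1, h2] <;> omega

/-! ### Optimal transports and the sparse case -/

/-- A transport of least insertion cost and, among these, with the fewest loops. -/
structure IsOptimalTransport (a b : V → ℕ) (M p : V → V → ℕ) : Prop where
  isTransport : IsTransport a b p
  cost_le : ∀ q, IsTransport a b q →
    transportCost (insertionCost M) p ≤ transportCost (insertionCost M) q
  loop_le : ∀ q, IsTransport a b q →
    transportCost (insertionCost M) q = transportCost (insertionCost M) p →
    transportCost loopCount p ≤ transportCost loopCount q

theorem exists_isOptimalTransport {a b : V → ℕ} (M : V → V → ℕ) (h : ∑ x, a x = ∑ x, b x) :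
    ∃ p, IsOptimalTransport a b M p := by
  obtain ⟨p₁, hp₁, h₁⟩ := exists_minimalFor_of_wellFoundedLT (fun p => IsTransport a b p)
    (fun p => transportCost (insertionCost M) p) (exists_isTransport a b h)
  obtain ⟨p, ⟨hp, hpc⟩, h₂⟩ := exists_minimalFor_of_wellFoundedLT
    (fun p => IsTransport a b p ∧ transportCost (insertionCost M) p =
      transportCost (insertionCost M) p₁)
    (fun p => transportCost (X := V) (Y := V) loopCount p) ⟨p₁, hp₁, rfl⟩
  have h₁' : ∀ q, IsTransport a b q →
      transportCost (insertionCost M) p₁ ≤ transportCost (insertionCost M) q := fun q hq =>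
    by
    rcases le_total (transportCost (insertionCost M) p₁) (transportCost (insertionCost M) q)
      with h | h
    · exact h
    · exact h₁ hq h
  refine ⟨p, hp, fun q hq => hpc.trans_le (h₁' q hq), fun q hq hqc => ?_⟩
  rcases le_total (transportCost loopCount p) (transportCost loopCount q) with h | h
  · exact h
  · exact h₂ ⟨hq, hqc.trans hpc⟩ h

theorem IsOptimalTransport.swap_le {a b : V → ℕ} {M p : V → V → ℕ}
    (hp : IsOptimalTransport a b M p) {x x' y y' : V} (hx : x ≠ x') (hy : y ≠ y')
    (h : 1 ≤ p x y) (h' : 1 ≤ p x' y') :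
    insertionCost M x y (p x y) + insertionCost M x' y' (p x' y') +
      insertionCost M x y' (p x y') + insertionCost M x' y (p x' y) ≤
    insertionCost M x y (p x y - 1) + insertionCost M x' y' (p x' y' - 1) +
      insertionCost M x y' (p x y' + 1) + insertionCost M x' y (p x' y + 1) := by
  have h1 := hp.cost_le _ (hp.isTransport.swapEntries hx hy h h')
  have h2 := transportCost_swapEntries (insertionCost M) p hx hy
  omega

/-- Exchanging loops at y and z for edges yz and zy saves 200 and costs at most 200. The tie is what
the second minimisation, over loops, excludes. -/
theorem IsOptimalTransport.loop_unique {a b : V → ℕ} {M p : V → V → ℕ}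
    (hp : IsOptimalTransport a b M p) {y z : V} (hy : p y y ≠ 0) (hz : p z z ≠ 0) : y = z := by
  by_contra hyz
  have hq := hp.isTransport.swapEntries hyz hyz (by omega) (by omega : 1 ≤ p z z)
  have h1 := hp.cost_le _ hq
  have h2 := transportCost_swapEntries (insertionCost M) p hyz hyz
  have l := transportCost_swapEntries loopCount p hyz hyz
  have e1 := insertionCost_pred_of_expensive (M := M) (x := y) (y := y) (n := p y y)
    (by omega) (.inl rfl)
  have e2 := insertionCost_pred_of_expensive (M := M) (x := z) (y := z) (n := p z z)
    (by omega) (.inl rfl)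
  have e3 := insertionCost_add_le M y z (p y z) 1
  have e4 := insertionCost_add_le M z y (p z y) 1
  have h3 := hp.loop_le _ hq (by omega)
  simp only [loopCount, if_true, hyz, Ne.symm hyz, if_false] at l
  omega

/-- In a sparse situation the optimal transport neither creates loops nor heavy bundles. -/
theorem IsOptimalTransport.cheap {a b : V → ℕ} {M p : V → V → ℕ}
    (hp : IsOptimalTransport a b M p) {d D : ℕ} (hD : ∑ x, b x = D)
    (hrow : ∀ x, ∑ w, M x w + a x ≤ d) (hcol : ∀ w, ∑ x, M x w + b w ≤ d)
    (hex : 8 * (excess a + excess b) ≤ D) (hd : d ≤ 3 * D) (hD₀ : 1000 ≤ D) {x w : V}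
    (hxw : 1 ≤ p x w) : x ≠ w ∧ M x w + p x w ≤ 200 := by
  by_contra hcon
  have hexp : x = w ∨ 200 < M x w + p x w := by
    by_cases h : x = w
    · exact .inl h
    · right; by_contra h'; exact hcon ⟨h, by omega⟩
  -- A unit outside this cover could be exchanged with the one at (x, w), saving 100 and costing at
  -- most 2.
  have cov := hp.isTransport.sum_le_of_cover (x := x) (y := w)
    (R := fun w' => x = w' ∨ 200 ≤ M x w' + p x w')
    (C := fun x' => x' = w ∨ 200 ≤ M x' w + p x' w) (hexp.imp id (by omega))
    (hexp.imp id (by omega)) (by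
      intro x' w' h' hx hw
      by_contra hno
      simp only [not_or, not_le] at hno
      have h1 := hp.swap_le hx hw hxw h'
      have h2 := insertionCost_pred_of_expensive hxw hexp
      have h3 := insertionCost_pred_le M x' w' (p x' w')
      have h4 := insertionCost_succ_of_cheap hno.1.1 hno.1.2
      have h5 := insertionCost_succ_of_cheap hno.2.1 hno.2.2
      omega)
  have c1 := sum_filter_le_card_add_excess b (fun w' => x = w' ∨ 200 ≤ M x w' + p x w')
  have c2 := sum_filter_le_card_add_excess a (fun x' => x' = w ∨ 200 ≤ M x' w + p x' w)
  -- Apart from column x, each such column takes 200 of the at most d edges in row x, so at most d /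
  -- 200 + 1 occur. The cover is then too small to carry D.
  have r1 : 200 * #{w' | (x = w' ∨ 200 ≤ M x w' + p x w') ∧ 1 ≤ b w'} ≤ d + 200 := by
    rw [card_filter, mul_sum]
    calc _ ≤ ∑ w', (M x w' + p x w' + if x = w' then 200 else 0) := by
          refine sum_le_sum fun w' _ => ?_
          by_cases h : x = w' <;> by_cases h' : 200 ≤ M x w' + p x w' <;> simp [h, h'] <;> grind
      _ ≤ _ := by
          rw [sum_add_distrib, sum_add_distrib, hp.isTransport.row]
          have := hrow x
          simp; omega
  have r2 : 200 * #{x' | (x' = w ∨ 200 ≤ M x' w + p x' w) ∧ 1 ≤ a x'} ≤ d + 200 := by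
    rw [card_filter, mul_sum]
    calc _ ≤ ∑ x', (M x' w + p x' w + if x' = w then 200 else 0) := by
          refine sum_le_sum fun x' _ => ?_
          by_cases h : x' = w <;> by_cases h' : 200 ≤ M x' w + p x' w <;> simp [h, h'] <;> grind
      _ ≤ _ := by
          rw [sum_add_distrib, sum_add_distrib, hp.isTransport.col]
          have := hcol w
          simp; omega
  omega

/-- The number of elements of the support of `b` that are not free for `x`. -/
noncomputable def blockedCount (b : V → ℕ) (M : V → V → ℕ) (x : V) : ℕ :=
  #{w | 1 ≤ b w ∧ (x = w ∨ 1 ≤ M x w)}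

/-- The number of blocked pairs in the product of the supports of `a` and `b`. -/
noncomputable def blockedPairs (a b : V → ℕ) (M : V → V → ℕ) : ℕ :=
  #{q : V × V | 1 ≤ a q.1 ∧ 1 ≤ b q.2 ∧ (q.1 = q.2 ∨ 1 ≤ M q.1 q.2)}

theorem blockedPairs_transpose (a b : V → ℕ) (M : V → V → ℕ) :
    blockedPairs b a (fun x y => M y x) = blockedPairs a b M := by
  refine card_bij (fun q _ => (q.2, q.1)) ?_ ?_ ?_
  · rintro ⟨x, y⟩ h; simp only [mem_filter, mem_univ, true_and] at h ⊢; grind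
  · rintro ⟨x, y⟩ _ ⟨x', y'⟩ _ h; simpa [and_comm] using h
  · rintro ⟨x, y⟩ h
    refine ⟨(y, x), ?_, rfl⟩
    simp only [mem_filter, mem_univ, true_and] at h ⊢; grind

theorem sum_blockedCount (a b : V → ℕ) (M : V → V → ℕ) :
    ∑ x with 1 ≤ a x, blockedCount b M x = blockedPairs a b M := by
  simp_rw [blockedPairs, blockedCount, card_filter, Fintype.sum_prod_type, sum_filter]
  refine sum_congr rfl fun x _ => ?_
  by_cases h : 1 ≤ a x <;> simp [h]

/-- Markov's inequality for the blocked counts over the support of `a`. -/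
theorem card_mul_le_blockedPairs (a b : V → ℕ) (M : V → V → ℕ) (n C : ℕ) :
    #{x | 1 ≤ a x ∧ n ≤ C * blockedCount b M x} * n ≤ C * blockedPairs a b M := by
  rw [← sum_blockedCount a b M, mul_sum, ← smul_eq_mul, ← sum_const]
  calc _ ≤ ∑ x with 1 ≤ a x ∧ n ≤ C * blockedCount b M x, C * blockedCount b M x :=
        sum_le_sum fun x hx => (mem_filter.1 hx).2.2
    _ ≤ _ := sum_le_sum_of_subset fun x hx => by simp at hx ⊢; exact hx.1

theorem card_nonfree_le (b : V → ℕ) (M p : V → V → ℕ) (x : V) :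
    #{w | (x = w ∨ 1 ≤ M x w + p x w) ∧ 1 ≤ b w} ≤ blockedCount b M x + ∑ w, p x w := by
  rw [blockedCount, card_filter, card_filter, ← sum_add_distrib]
  refine sum_le_sum fun w _ => ?_
  by_cases h1 : x = w <;> by_cases h2 : 1 ≤ M x w <;> by_cases h3 : 1 ≤ b w <;>
    simp [h1, h3] <;> split_ifs <;> grind

/-- In a sparse situation with few blocked pairs the optimal transport is almost free. -/
theorem IsOptimalTransport.cost_le_of_sparse {a b : V → ℕ} {M p : V → V → ℕ}
    (hp : IsOptimalTransport a b M p) {d D L : ℕ} (hL : 1 ≤ L) (hdL : d = 10000000000000 * L)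
    (hD : ∑ x, b x = D)
    (hrow : ∀ x, ∑ w, M x w + a x ≤ d) (hcol : ∀ w, ∑ x, M x w + b w ≤ d)
    (hN : blockedPairs a b M ≤ 20000000000000 * (L * L))
    (hex : 8 * (excess a + excess b) ≤ D) (hd : d ≤ 3 * D) :
    (∀ x, p x x = 0) ∧
      transportCost (insertionCost M) p ≤ 2 * (surplus a + surplus b) + 19200 * L := by
  have hcheap := fun x w => hp.cheap hD hrow hcol hex hd (by omega) (x := x) (w := w)
  refine ⟨fun x => ?_, ?_⟩
  · by_contra h; exact (hcheap x x (by omega)).1 rfl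
  -- Moving a costly unit into free positions would save at least 1, so the non-free columns for x
  -- and rows for w cover D. The excesses account for at most D / 8; the rest needs a large entry of
  -- `a` or `b`, or many blocked pairs.
  have hcostly : ∀ x w, 1 ≤ p x w → 2 ≤ M x w + p x w →
      (400 < a x ∨ 1 ≤ a x ∧ D ≤ 4 * blockedCount b M x) ∨
      (400 < b w ∨ 1 ≤ b w ∧ D ≤ 4 * blockedCount a (fun i j => M j i) w) := by
    intro x w hxw h2
    have hne := (hcheap x w hxw).1
    have cov := hp.isTransport.sum_le_of_cover (x := x) (y := w)
      (R := fun w' => x = w' ∨ 1 ≤ M x w' + p x w')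
      (C := fun x' => w = x' ∨ 1 ≤ M x' w + p x' w) (.inr (by omega)) (.inr (by omega)) (by
        intro x' w' h' hx hw
        by_contra hno
        simp only [not_or, not_le] at hno
        have h1 := hp.swap_le hx hw hxw h'
        have h2 := insertionCost_pred_of_costly (M := M) (x := x) (y := w) hxw (.inr h2)
        have h3 := insertionCost_pred_le M x' w' (p x' w')
        have h4 := insertionCost_succ_of_free (M := M) hno.1.1 (by omega : _ + p x w' = 0)
        have h5 := insertionCost_succ_of_free (M := M) (Ne.symm hno.2.1)
          (by omega : _ + p x' w = 0)
        omega)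
    have c1 := sum_filter_le_card_add_excess b (fun w' => x = w' ∨ 1 ≤ M x w' + p x w')
    have c2 := sum_filter_le_card_add_excess a (fun x' => w = x' ∨ 1 ≤ M x' w + p x' w)
    have c3 := card_nonfree_le b M p x
    have c4 := card_nonfree_le a (fun i j => M j i) (fun i j => p j i) w
    rw [hp.isTransport.row] at c3
    simp only [hp.isTransport.col] at c4
    have := hp.isTransport.le_row x w
    have := hp.isTransport.le_col x w
    omega
  have hE1 := card_mul_le_blockedPairs a b M D 4
  have hE2 := card_mul_le_blockedPairs b a (fun i j => M j i) D 4
  rw [blockedPairs_transpose] at hE2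
  set E1 : Finset V := {x | 1 ≤ a x ∧ D ≤ 4 * blockedCount b M x}
  set E2 : Finset V := {w | 1 ≤ b w ∧ D ≤ 4 * blockedCount a (fun i j => M j i) w}
  have key : ∀ n : ℕ, n * D ≤ 4 * blockedPairs a b M → n ≤ 24 * L := by
    intro n hn
    by_contra hcon
    have : (24 * L + 1) * D ≤ n * D := Nat.mul_le_mul_right _ (by omega)
    nlinarith
  have hE1' := key _ hE1
  have hE2' := key _ hE2
  have entry : ∀ x w, insertionCost M x w (p x w) ≤
      (if 400 < a x ∨ x ∈ E1 then p x w else 0) + if 400 < b w ∨ w ∈ E2 then p x w else 0 := by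
    intro x w
    by_cases h1 : 1 ≤ p x w
    · by_cases h2 : 2 ≤ M x w + p x w
      · have h3 := hcheap x w h1
        have h4 := insertionCost_le_self h3.1 h3.2
        have h5 := hcostly x w h1 h2
        have e1 : x ∈ E1 ↔ 1 ≤ a x ∧ D ≤ 4 * blockedCount b M x := by simp [E1]
        have e2 : w ∈ E2 ↔ 1 ≤ b w ∧ D ≤ 4 * blockedCount a (fun i j => M j i) w := by simp [E2]
        rw [← e1, ← e2] at h5
        rcases h5 with h5 | h5
        · rw [if_pos h5]; omega
        · rw [if_pos h5]; omega
      · rw [insertionCost_eq_zero fun _ => ⟨(hcheap x w h1).1, by omega⟩]; exact Nat.zero_le _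
    · rw [insertionCost_eq_zero fun h => absurd h h1]; exact Nat.zero_le _
  -- Above 400, f x is at most 2 * (f x - 200); the other vertices of E contribute at most 400 each.
  have bound : ∀ (f : V → ℕ) (E : Finset V),
      ∑ x, (if 400 < f x ∨ x ∈ E then f x else 0) ≤ 2 * surplus f + 400 * #E := by
    intro f E
    have : 400 * #E = ∑ x, if x ∈ E then 400 else 0 := by
      rw [← sum_filter]; simp [mul_comm]
    rw [this, surplus, mul_sum, ← sum_add_distrib]
    refine sum_le_sum fun x _ => ?_
    by_cases h1 : 400 < f x <;> by_cases h2 : x ∈ E <;> simp [h1, h2] <;> omega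
  calc transportCost (insertionCost M) p
      ≤ ∑ x, ∑ w, ((if 400 < a x ∨ x ∈ E1 then p x w else 0) +
        if 400 < b w ∨ w ∈ E2 then p x w else 0) :=
        sum_le_sum fun x _ => sum_le_sum fun w _ => entry x w
    _ = ∑ x, (if 400 < a x ∨ x ∈ E1 then a x else 0) +
        ∑ w, (if 400 < b w ∨ w ∈ E2 then b w else 0) := by
        simp_rw [sum_add_distrib]
        congr 1
        · refine sum_congr rfl fun x _ => ?_
          split_ifs <;> simp [hp.isTransport.row]
        · rw [sum_comm]
          refine sum_congr rfl fun x _ => ?_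
          split_ifs <;> simp [hp.isTransport.col]
    _ ≤ _ := by
        have := bound a E1
        have := bound b E2
        omega

/-! ### Two explicit transports for heavy bundles -/

/-- The insertion cost, where an additional row `none` is free of charge. -/
noncomputable def insertionCostOption (M : V → V → ℕ) : Option V → V → ℕ → ℕ
  | none, _, _ => 0
  | some x, y, n => insertionCost M x y n

theorem IsTransport.exists_min {X Y : Type*} [Fintype X] [Fintype Y] {a : X → ℕ} {b : Y → ℕ}
    (c : X → Y → ℕ → ℕ) (h : ∑ x, a x = ∑ y, b y) :
    ∃ p, IsTransport a b p ∧ ∀ q, IsTransport a b q → transportCost c p ≤ transportCost c q := by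
  obtain ⟨p, hp, h₁⟩ := exists_minimalFor_of_wellFoundedLT (fun p => IsTransport a b p)
    (fun p => transportCost c p) (exists_isTransport a b h)
  refine ⟨p, hp, fun q hq => ?_⟩
  rcases le_total (transportCost c p) (transportCost c q) with h | h
  · exact h
  · exact h₁ hq h

theorem sum_univ_ite_mem (E : Finset V) (f : V → ℕ) :
    ∑ x, (if x ∈ E then f x else 0) = ∑ x ∈ E, f x := by
  simp

/-- Truncate all entries of `a` and `b` at 200, with a free dummy row balancing the totals. An
optimal transport of the truncated vectors pays only in the few rows and columns with many blocked
pairs. The remaining `surplus a` units are inserted arbitrarily at price at most 100 each. -/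
theorem exists_isTransport_of_blocks {a b : V → ℕ} {M : V → V → ℕ} {D L : ℕ} (hL : 1 ≤ L)
    (ha : ∑ x, a x = D) (hb : ∑ x, b x = D)
    (hN : blockedPairs a b M ≤ 20000000000000 * (L * L))
    (hd : 10000000000000 * L ≤ 3 * D) (hab : surplus b ≤ surplus a)
    (hbD : 10 * surplus b ≤ 9 * D) :
    ∃ p, IsTransport a b p ∧
      transportCost (insertionCost M) p ≤ 100 * surplus a + 1920000000 * L := by
  have sa := sum_min_add_surplus a
  have sb := sum_min_add_surplus b
  obtain ⟨a', ha'⟩ : ∃ a' : Option V → ℕ,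
      a' = fun o => o.elim (surplus a - surplus b) (fun x => min (a x) 200) := ⟨_, rfl⟩
  obtain ⟨b', hb'⟩ : ∃ b' : V → ℕ, b' = fun w => min (b w) 200 := ⟨_, rfl⟩
  have hsum : ∑ o, a' o = ∑ w, b' w := by
    rw [Fintype.sum_option]; simp only [ha', hb', Option.elim]; omega
  obtain ⟨q, hq, hmin⟩ := IsTransport.exists_min (insertionCostOption M) hsum
  have hb'D : D ≤ 10 * ∑ w, b' w := by simp only [hb']; omega
  have hcostly : ∀ x w, 1 ≤ q (some x) w → x = w ∨ 2 ≤ M x w + q (some x) w →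
      (1 ≤ a x ∧ D ≤ 8000 * blockedCount b M x) ∨
      (1 ≤ b w ∧ D ≤ 8000 * blockedCount a (fun i j => M j i) w) := by
    intro x w hxw h2
    -- The row `none` is left out of the cover because exchanging with its units is free.
    have cov := hq.sum_le_of_cover (x := some x) (y := w)
      (R := fun w' => x = w' ∨ 1 ≤ M x w' + q (some x) w')
      (C := fun o => ∃ x', o = some x' ∧ (w = x' ∨ 1 ≤ M x' w + q (some x') w))
      (.inr (by omega)) ⟨x, rfl, .inr (by omega)⟩ (by
        intro o w' h' hx hw
        by_contra hno
        simp only [not_or, not_le] at hno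
        have h0 := hmin _ (hq.swapEntries hx hw hxw h')
        have h1 := transportCost_swapEntries (insertionCostOption M) q hx hw
        have h3 := insertionCost_pred_of_costly hxw h2
        have h4 := insertionCost_succ_of_free (M := M) hno.1.1 (by omega : _ + q (some x) w' = 0)
        cases o with
        | none => simp only [insertionCostOption] at h1; omega
        | some x' =>
          have hno2 : ¬ (w = x' ∨ 1 ≤ M x' w + q (some x') w) := fun h => hno.2 ⟨x', rfl, h⟩
          simp only [not_or, not_le] at hno2
          have h5 := insertionCost_pred_le M x' w' (q (some x') w')
          have h6 := insertionCost_succ_of_free (M := M) (Ne.symm hno2.1)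
            (by omega : _ + q (some x') w = 0)
          simp only [insertionCostOption] at h1
          omega)
    have c1 : ∑ w' with (x = w' ∨ 1 ≤ M x w' + q (some x) w'), b' w' ≤
        200 * #{w' | (x = w' ∨ 1 ≤ M x w' + q (some x) w') ∧ 1 ≤ b w'} := by
      rw [sum_filter, card_filter, mul_sum]
      refine sum_le_sum fun w' _ => ?_
      simp only [hb']; split_ifs <;> grind
    have c2 : ∑ o with (∃ x', o = some x' ∧ (w = x' ∨ 1 ≤ M x' w + q (some x') w)), a' o ≤
        200 * #{x' | (w = x' ∨ 1 ≤ M x' w + q (some x') w) ∧ 1 ≤ a x'} := by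
      rw [sum_filter, card_filter, mul_sum, Fintype.sum_option]
      simp only [reduceCtorEq, false_and, exists_false, if_false, zero_add, Option.some.injEq,
        exists_eq_left']
      refine sum_le_sum fun x' _ => ?_
      simp only [ha', Option.elim]; split_ifs <;> grind
    have c3 := card_nonfree_le b M (fun x w => q (some x) w) x
    have c4 := card_nonfree_le a (fun i j => M j i) (fun i j => q (some j) i) w
    simp only [hq.row] at c3
    have c5 : ∑ x', q (some x') w ≤ b' w := by
      rw [← hq.col w, Fintype.sum_option]; omega
    have := hq.le_row (some x) w
    have := hq.le_col (some x) w
    have : a' (some x) = min (a x) 200 := by rw [ha']; rfl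
    have : b' w = min (b w) 200 := by rw [hb']
    have : D ≤ 8000 * blockedCount b M x ∨ D ≤ 8000 * blockedCount a (fun i j => M j i) w := by
      omega
    omega
  have hE1 := card_mul_le_blockedPairs a b M D 8000
  have hE2 := card_mul_le_blockedPairs b a (fun i j => M j i) D 8000
  rw [blockedPairs_transpose] at hE2
  set E1 : Finset V := {x | 1 ≤ a x ∧ D ≤ 8000 * blockedCount b M x}
  set E2 : Finset V := {w | 1 ≤ b w ∧ D ≤ 8000 * blockedCount a (fun i j => M j i) w}
  have key : ∀ n : ℕ, n * D ≤ 8000 * blockedPairs a b M → n ≤ 48000 * L := by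
    intro n hn
    by_contra hcon
    have : (48000 * L + 1) * D ≤ n * D := Nat.mul_le_mul_right _ (by omega)
    nlinarith
  have hE1' := key _ hE1
  have hE2' := key _ hE2
  have entry : ∀ x w, insertionCost M x w (q (some x) w) ≤
      100 * ((if x ∈ E1 then q (some x) w else 0) + if w ∈ E2 then q (some x) w else 0) := by
    intro x w
    by_cases h1 : 1 ≤ q (some x) w
    · by_cases h2 : x = w ∨ 2 ≤ M x w + q (some x) w
      · have h4 := insertionCost_le M x w (q (some x) w)
        have h5 := hcostly x w h1 h2
        have e1 : x ∈ E1 ↔ 1 ≤ a x ∧ D ≤ 8000 * blockedCount b M x := by simp [E1]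
        have e2 : w ∈ E2 ↔ 1 ≤ b w ∧ D ≤ 8000 * blockedCount a (fun i j => M j i) w := by
          simp [E2]
        rw [← e1, ← e2] at h5
        rcases h5 with h5 | h5
        · rw [if_pos h5]; omega
        · rw [if_pos h5]; omega
      · rw [not_or] at h2
        rw [insertionCost_eq_zero fun _ => ⟨h2.1, by omega⟩]; exact Nat.zero_le _
    · rw [insertionCost_eq_zero fun h => absurd h h1]; exact Nat.zero_le _
  have hq1 : ∀ x, ∑ w, q (some x) w ≤ 200 := fun x => by
    rw [hq.row, ha']; exact min_le_right _ _
  have hq2 : ∀ w, ∑ x, q (some x) w ≤ b' w := fun w => by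
    rw [← hq.col w, Fintype.sum_option]; omega
  have cq : transportCost (insertionCost M) (fun x w => q (some x) w) ≤ 1920000000 * L := by
    calc _ ≤ ∑ x, ∑ w, 100 * ((if x ∈ E1 then q (some x) w else 0) +
          if w ∈ E2 then q (some x) w else 0) :=
          sum_le_sum fun x _ => sum_le_sum fun w _ => entry x w
      _ = 100 * (∑ x ∈ E1, ∑ w, q (some x) w + ∑ w ∈ E2, ∑ x, q (some x) w) := by
          simp_rw [← mul_sum, sum_add_distrib]
          congr 2
          · rw [← sum_univ_ite_mem E1]
            refine sum_congr rfl fun x _ => ?_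
            by_cases h : x ∈ E1 <;> simp only [h, if_true, if_false, sum_const_zero]
          · rw [← sum_univ_ite_mem E2, sum_comm]
            refine sum_congr rfl fun x _ => ?_
            by_cases h : x ∈ E2 <;> simp only [h, if_true, if_false, sum_const_zero]
      _ ≤ 100 * (∑ x ∈ E1, 200 + ∑ w ∈ E2, 200) := by
          gcongr with x _ w _
          · exact hq1 x
          · refine (hq2 w).trans ?_
            rw [hb']; exact min_le_right _ _
      _ ≤ _ := by simp only [sum_const, smul_eq_mul]; omega
  have e1 : ∑ x, (a x - min (a x) 200) = surplus a := sum_congr rfl fun x _ => by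
    omega
  obtain ⟨r, hr⟩ := exists_isTransport (fun x => a x - min (a x) 200)
    (fun w => b w - ∑ x, q (some x) w) (by
      have e2 : ∑ w, (b w - ∑ x, q (some x) w) + ∑ w, ∑ x, q (some x) w = ∑ w, b w := by
        rw [← sum_add_distrib]
        refine sum_congr rfl fun w _ => ?_
        have := hq2 w
        simp only [hb'] at this; omega
      have e3 : ∑ w, ∑ x, q (some x) w = ∑ x, min (a x) 200 := by
        rw [sum_comm]; simp only [hq.row, ha', Option.elim]
      omega)
  refine ⟨fun x w => q (some x) w + r x w, ⟨fun x => ?_, fun w => ?_⟩, ?_⟩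
  · rw [sum_add_distrib, hr.row, hq.row]; simp only [ha', Option.elim]; omega
  · rw [sum_add_distrib, hr.col]; have := hq2 w; simp only [hb'] at this; omega
  calc _ ≤ ∑ x, ∑ w, (insertionCost M x w (q (some x) w) + 100 * r x w) :=
        sum_le_sum fun x _ => sum_le_sum fun w _ => insertionCost_add_le _ _ _ _ _
    _ = transportCost (insertionCost M) (fun x w => q (some x) w) + 100 * surplus a := by
        simp_rw [sum_add_distrib, ← mul_sum, hr.row, e1]
        rfl
    _ ≤ _ := by omega

/-- A maximal partial matrix without loops or bundles above 200 costs at most 1 per unit, and the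
rest at most 100 per unit. If row x is unfinished, every unfinished column is x itself or already
has 200 edges from x, which bounds the rest. -/
theorem exists_isTransport_of_excess {a b : V → ℕ} {M : V → V → ℕ} {d D : ℕ}
    (ha : ∑ x, a x = D) (hb : ∑ x, b x = D) (hrow : ∀ x, ∑ w, M x w + a x ≤ d) :
    ∃ p, IsTransport a b p ∧
      transportCost (insertionCost M) p ≤ D + 100 * (d / 200 + 1 + excess b) := by
  let good : (V → V → ℕ) → Prop := fun q => (∀ x, ∑ w, q x w ≤ a x) ∧ (∀ w, ∑ x, q x w ≤ b w) ∧
    ∀ x w, 1 ≤ q x w → x ≠ w ∧ M x w + q x w ≤ 200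
  obtain ⟨q, hq, hmax⟩ : ∃ q, good q ∧ ∀ q', good q' → ∑ x, ∑ w, q' x w ≤ ∑ x, ∑ w, q x w := by
    obtain ⟨q, hq, hmin⟩ := exists_minimalFor_of_wellFoundedLT good
      (fun q => D - ∑ x, ∑ w, q x w) ⟨fun _ _ => 0, by simp, by simp, by simp⟩
    refine ⟨q, hq, fun q' hq' => ?_⟩
    by_contra hlt
    have h1 : ∑ x, ∑ w, q' x w ≤ D := ha ▸ sum_le_sum fun x _ => hq'.1 x
    have h2 := hmin hq' (by simp only; omega)
    simp only at h2
    omega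
  obtain ⟨hqa, hqb, hq⟩ := hq
  have e1 : ∑ x, (a x - ∑ w, q x w) + ∑ x, ∑ w, q x w = D := by
    rw [← ha, ← sum_add_distrib]
    exact sum_congr rfl fun x _ => by have := hqa x; omega
  have e2 : ∑ w, (b w - ∑ x, q x w) + ∑ x, ∑ w, q x w = D := by
    rw [← hb, sum_comm, ← sum_add_distrib]
    exact sum_congr rfl fun x _ => by have := hqb x; omega
  have hs : ∑ x, (a x - ∑ w, q x w) ≤ d / 200 + 1 + excess b := by
    by_contra hcon
    obtain ⟨x, -, hx⟩ := exists_ne_zero_of_sum_ne_zero (s := univ)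
      (f := fun x => a x - ∑ w, q x w) (by omega)
    have hblock : ∀ w, ∑ i, q i w < b w → x = w ∨ 200 ≤ M x w + q x w := by
      intro w hw
      by_contra hno
      rw [not_or, not_le] at hno
      have hsum : ∀ i j, q i j + (if i = x ∧ j = w then 1 else 0) =
          if i = x ∧ j = w then q x w + 1 else q i j := by
        intro i j; split_ifs with h
        · rw [h.1, h.2]
        · rfl
      have := hmax (fun i j => q i j + if i = x ∧ j = w then 1 else 0)
        ⟨fun i => ?_, fun j => ?_, fun i j hij => ?_⟩
      · simp only [sum_add_distrib] at this
        have : ∑ i, ∑ j, (if i = x ∧ j = w then 1 else 0) = 1 := by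
          simp [ite_and]
        omega
      · rw [sum_add_distrib]
        by_cases h : i = x
        · subst h; simp; omega
        · simp [h, hqa i]
      · rw [sum_add_distrib]
        by_cases h : j = w
        · subst h; simp; omega
        · simp [h, hqb j]
      · simp only [hsum] at hij ⊢
        split_ifs at hij ⊢ with h
        · rw [h.1, h.2]; exact ⟨hno.1, by omega⟩
        · exact hq i j hij
    have h1 : ∑ w, (b w - ∑ x, q x w) ≤ ∑ w with (x = w ∨ 200 ≤ M x w + q x w), b w := by
      rw [sum_filter]
      refine sum_le_sum fun w _ => ?_
      by_cases h : ∑ i, q i w < b w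
      · rw [if_pos (hblock w h)]; omega
      · omega
    have c1 := sum_filter_le_card_add_excess b (fun w => x = w ∨ 200 ≤ M x w + q x w)
    have r1 : 200 * #{w' | (x = w' ∨ 200 ≤ M x w' + q x w') ∧ 1 ≤ b w'} ≤ d + 200 := by
      rw [card_filter, mul_sum]
      calc _ ≤ ∑ w', (M x w' + q x w' + if x = w' then 200 else 0) := by
            refine sum_le_sum fun w' _ => ?_
            by_cases h : x = w' <;> by_cases h' : 200 ≤ M x w' + q x w' <;> simp [h, h'] <;> grind
        _ ≤ _ := by
            rw [sum_add_distrib, sum_add_distrib]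
            have := hrow x
            have := hqa x
            simp; omega
    omega
  obtain ⟨r, hr⟩ := exists_isTransport (fun x => a x - ∑ w, q x w) (fun w => b w - ∑ x, q x w)
    (by omega)
  refine ⟨fun x w => q x w + r x w, ⟨fun x => ?_, fun w => ?_⟩, ?_⟩
  · rw [sum_add_distrib, hr.row]; have := hqa x; omega
  · rw [sum_add_distrib, hr.col]; have := hqb w; omega
  calc _ ≤ ∑ x, ∑ w, (q x w + 100 * r x w) := by
        refine sum_le_sum fun x _ => sum_le_sum fun w _ => ?_
        refine (insertionCost_add_le _ _ _ _ _).trans (Nat.add_le_add_right ?_ _)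
        by_cases h : 1 ≤ q x w
        · exact insertionCost_le_self (hq x w h).1 (hq x w h).2
        · rw [insertionCost_eq_zero fun h' => absurd h' h]; exact Nat.zero_le _
    _ = ∑ x, ∑ w, q x w + 100 * ∑ x, (a x - ∑ w, q x w) := by
        simp_rw [sum_add_distrib, ← mul_sum, hr.row]
    _ ≤ _ := by omega

theorem transportCost_transpose {M p : V → V → ℕ} :
    transportCost (insertionCost (fun i j => M j i)) (fun x y => p y x) =
      transportCost (insertionCost M) p := by
  unfold transportCost
  rw [sum_comm]
  simp_rw [insertionCost_transpose]

/-- The block transport saves `excess a - surplus a + excess b + 99 * surplus b` up to O(L). If this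
is too little, `excess b` is small and `surplus a` is close to `excess a`, hence to at least D / 8;
the second transport, of cost about D + d / 2, then saves enough. -/
theorem cost_dichotomy_of_surplus_le {a b : V → ℕ} {M p : V → V → ℕ}
    (hp : ∀ q, IsTransport a b q →
      transportCost (insertionCost M) p ≤ transportCost (insertionCost M) q)
    {d D L : ℕ} (hL : 1 ≤ L) (hdL : d = 10000000000000 * L)
    (ha : ∑ x, a x = D) (hb : ∑ x, b x = D)
    (hrow : ∀ x, ∑ w, M x w + a x ≤ d)
    (hN : blockedPairs a b M ≤ 20000000000000 * (L * L))
    (hd : d ≤ 3 * D) (hab : surplus b ≤ surplus a)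
    (hbD : 10 * surplus b ≤ 9 * D) (hex : D < 8 * (excess a + excess b)) :
    transportCost (insertionCost M) p + 30000000000 * L ≤
      excess a + 99 * surplus a + (excess b + 99 * surplus b) := by
  obtain ⟨q, hq, hqc⟩ := exists_isTransport_of_blocks hL ha hb hN (by omega) hab hbD
  obtain ⟨r, hr, hrc⟩ := exists_isTransport_of_excess (M := M) ha hb hrow
  have h1 := hp q hq
  have h2 := hp r hr
  have := surplus_le_excess a
  have := surplus_le_excess b
  omega

/-- The local alternative: removing the vertex gains a lot, or it costs almost nothing. -/
theorem IsOptimalTransport.cost_dichotomy {a b : V → ℕ} {M p : V → V → ℕ}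
    (hp : IsOptimalTransport a b M p) {d D L : ℕ} (hL : 1 ≤ L) (hdL : d = 10000000000000 * L)
    (ha : ∑ x, a x = D) (hb : ∑ x, b x = D)
    (hrow : ∀ x, ∑ w, M x w + a x ≤ d) (hcol : ∀ w, ∑ x, M x w + b w ≤ d)
    (hN : blockedPairs a b M ≤ 20000000000000 * (L * L))
    (hd : d ≤ 3 * D) :
    (transportCost (insertionCost M) p + 30000000000 * L ≤
      ∑ x, bundleWeight (a x) + ∑ x, bundleWeight (b x)) ∨
    ((∀ x, p x x = 0) ∧
      transportCost (insertionCost M) p ≤ 2 * (surplus a + surplus b) + 19200 * L) := by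
  rw [sum_bundleWeight, sum_bundleWeight]
  by_cases hex : 8 * (excess a + excess b) ≤ D
  · exact .inr (hp.cost_le_of_sparse hL hdL hb hrow hcol hN hex hd)
  left
  have := surplus_le_excess a
  have := surplus_le_excess b
  have hmax : transportCost (insertionCost M) p ≤ 100 * D := by
    calc _ ≤ ∑ x, ∑ w, 100 * p x w :=
          sum_le_sum fun x _ => sum_le_sum fun w _ => insertionCost_le _ _ _ _
      _ = _ := by simp_rw [← mul_sum, hp.isTransport.row, ha]
  rcases le_total (surplus b) (surplus a) with hab | hab
  -- If even the smaller surplus exceeds 9D / 10, the bundles weigh at least 180 D, against a price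
  -- of at most 100 D.
  · by_cases hbD : 10 * surplus b ≤ 9 * D
    · exact cost_dichotomy_of_surplus_le hp.cost_le hL hdL ha hb hrow hN hd hab hbD (by omega)
    · omega
  · by_cases hbD : 10 * surplus a ≤ 9 * D
    · have := cost_dichotomy_of_surplus_le (a := b) (b := a) (M := fun i j => M j i)
        (p := fun i j => p j i) (fun q hq => by
          have := hp.cost_le _ hq.transpose
          rw [transportCost_transpose]
          rwa [← transportCost_transpose (M := M) (p := fun x y => q y x)]
            at this) hL hdL hb ha hcol (by rw [blockedPairs_transpose]; exact hN) hd hab hbD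
        (by omega)
      rw [transportCost_transpose] at this
      omega
    · omega

end InsertionCost

/-! ### Multigraphs routed in a digraph -/

section Routing

open Finset Digraph
open scoped Classical

variable {V : Type*}

theorem exists_nodup_path_of_reflTransGen {r : V → V → Prop} {x y : V}
    (h : Relation.ReflTransGen r x y) :
    ∃ l : List V, l.IsChain r ∧ l.Nodup ∧ l.head? = some x ∧ l.getLast? = some y := by
  induction h using Relation.ReflTransGen.head_induction_on with
  | refl => exact ⟨[y], by simp⟩
  | @head a c hac _ ih =>
    obtain ⟨l, hc, hn, hh, hl⟩ := ih
    by_cases ha : a ∈ l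
    · obtain ⟨s, t, rfl⟩ := List.append_of_mem ha
      refine ⟨a :: t, ?_, ?_, rfl, ?_⟩
      · exact (List.isChain_append.1 hc).2.1
      · exact (List.nodup_append.1 hn).2.1
      · simpa using hl
    · cases l with
      | nil => simp at hh
      | cons b t =>
        simp only [List.head?_cons, Option.some.injEq] at hh
        subst hh
        exact ⟨a :: b :: t, by simp [hac, hc], by simp [ha, hn], rfl, by simpa using hl⟩

theorem rel_of_mem_pathEdges {r : V → V → Prop} {l : List V} (h : l.IsChain r) {e : V × V}
    (he : e ∈ pathEdges l) : r e.1 e.2 := by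
  induction l with
  | nil => simp [pathEdges] at he
  | cons a t ih =>
    cases t with
    | nil => simp [pathEdges] at he
    | cons b t =>
      simp only [pathEdges, List.tail_cons, List.zip_cons_cons, List.mem_cons] at he
      rw [List.isChain_cons_cons] at h
      rcases he with rfl | he
      · exact h.1
      · exact ih h.2 he

/-- Every edge of the multigraph with multiplicities `m` can be assigned a connection in `G`
between its ends, distinct edges using disjoint edge sets. -/
def IsRouted (G : Digraph V) (m : V → V → ℕ) : Prop :=
  ∃ P : V → V → ℕ → Set (V × V),
    (∀ x y i, i < m x y → P x y i ⊆ G.edgeSet ∧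
      Relation.ReflTransGen (fun a b => (a, b) ∈ P x y i) x y) ∧
    ∀ x y i x' y' i', i < m x y → i' < m x' y' → (x, y, i) ≠ (x', y', i') →
      Disjoint (P x y i) (P x' y' i')

variable {G : Digraph V} {m : V → V → ℕ}

theorem IsRouted.mono (h : IsRouted G m) {m' : V → V → ℕ} (hm : ∀ x y, m' x y ≤ m x y) :
    IsRouted G m' := by
  obtain ⟨P, h1, h2⟩ := h
  exact ⟨P, fun x y i hi => h1 x y i (hi.trans_le (hm x y)), fun x y i x' y' i' hi hi' =>
    h2 x y i x' y' i' (hi.trans_le (hm x y)) (hi'.trans_le (hm x' y'))⟩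

theorem isRouted_adj (G : Digraph V) : IsRouted G (fun x y => if G.Adj x y then 1 else 0) := by
  refine ⟨fun x y _ => {(x, y)}, fun x y i hi => ?_, fun x y i x' y' i' hi hi' hne => ?_⟩
  · have hxy : G.Adj x y := by by_contra h; simp [h] at hi
    refine ⟨by simpa [edgeSet] using hxy, .single rfl⟩
  · rw [Set.disjoint_singleton]
    have : i = 0 := by simp only at hi; split_ifs at hi <;> omega
    have : i' = 0 := by simp only at hi'; split_ifs at hi' <;> omega
    grind

/-- Replacing an edge from `u` to `x` and an edge from `x` to `w` by an edge from `u` to `w`. -/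
theorem IsRouted.split (h : IsRouted G m) {u x w : V} (hux : u ≠ x) (hxw : x ≠ w) (huw : u ≠ w)
    (h1 : 1 ≤ m u x) (h2 : 1 ≤ m x w) :
    IsRouted G fun a b => if a = u ∧ b = w then m u w + 1 else if a = u ∧ b = x then m u x - 1
      else if a = x ∧ b = w then m x w - 1 else m a b := by
  obtain ⟨P, hP, hd⟩ := h
  set m' : V → V → ℕ := fun a b => if a = u ∧ b = w then m u w + 1 else
    if a = u ∧ b = x then m u x - 1 else if a = x ∧ b = w then m x w - 1 else m a b with hm'
  have old : ∀ a b i, i < m' a b → ¬ (a = u ∧ b = w ∧ i = m u w) → i < m a b ∧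
      (a, b, i) ≠ (u, x, m u x - 1) ∧ (a, b, i) ≠ (x, w, m x w - 1) := by
    intro a b i hi hne
    simp only [hm'] at hi
    split_ifs at hi with c1 c2 c3 <;> grind
  -- The new copy, with index m u w, unites the connections of the last copies of u → x and x → w,
  -- whose indices disappear.
  refine ⟨fun a b i => if a = u ∧ b = w ∧ i = m u w then
    P u x (m u x - 1) ∪ P x w (m x w - 1) else P a b i, fun a b i hi => ?_,
    fun a b i a' b' i' hi hi' hne => ?_⟩
  · by_cases hc : a = u ∧ b = w ∧ i = m u w
    · simp only [if_pos hc]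
      obtain ⟨rfl, rfl, rfl⟩ := hc
      obtain ⟨s1, r1⟩ := hP a x (m a x - 1) (by omega)
      obtain ⟨s2, r2⟩ := hP x b (m x b - 1) (by omega)
      exact ⟨Set.union_subset s1 s2, Relation.ReflTransGen.trans (Relation.ReflTransGen.mono
        (fun _ _ h => Set.mem_union_left _ h) _ _ r1)
        (Relation.ReflTransGen.mono (fun _ _ h => Set.mem_union_right _ h) _ _ r2)⟩
    · simp only [if_neg hc]
      exact hP a b i (old a b i hi hc).1
  · by_cases hc : a = u ∧ b = w ∧ i = m u w <;> by_cases hc' : a' = u ∧ b' = w ∧ i' = m u w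
    · grind
    · simp only [if_pos hc, if_neg hc']
      obtain ⟨o1, o2, o3⟩ := old a' b' i' hi' hc'
      exact Set.disjoint_union_left.2 ⟨hd _ _ _ _ _ _ (by omega) o1 o2.symm,
        hd _ _ _ _ _ _ (by omega) o1 o3.symm⟩
    · simp only [if_neg hc, if_pos hc']
      obtain ⟨o1, o2, o3⟩ := old a b i hi hc
      exact Set.disjoint_union_right.2 ⟨hd _ _ _ _ _ _ o1 (by omega) o2,
        hd _ _ _ _ _ _ o1 (by omega) o3⟩
    · simp only [if_neg hc, if_neg hc']
      exact hd _ _ _ _ _ _ (old a b i hi hc).1 (old a' b' i' hi' hc').1 hne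

/-- The multigraph obtained from `m` by removing `v` and inserting the off-diagonal entries
of `p`. -/
noncomputable def bypass (m : V → V → ℕ) (v : V) (p : V → V → ℕ) : V → V → ℕ := fun x w =>
  if x = v ∨ w = v then 0 else m x w + if x = w then 0 else p x w

/-- Each off-diagonal unit of `p` is one splitting at v. A diagonal unit, like any unmatched edge at
v, is discarded. -/
theorem IsRouted.bypass [Fintype V] (h : IsRouted G m) {v : V} (hv : m v v = 0) (p : V → V → ℕ)
    (hrow : ∀ x, ∑ w, p x w ≤ m x v) (hcol : ∀ w, ∑ x, p x w ≤ m v w) :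
    IsRouted G (bypass m v p) := by
  induction hn₀ : ∑ x, ∑ w, p x w generalizing m p with
  | zero =>
    refine h.mono fun x w => ?_
    have h0 : p x w = 0 := by
      have := (Finset.sum_eq_zero_iff.1 hn₀) x (mem_univ _)
      exact (Finset.sum_eq_zero_iff.1 this) w (mem_univ _)
    unfold _root_.bypass; split_ifs <;> omega
  | succ n ih =>
    obtain ⟨x, -, hx⟩ := exists_ne_zero_of_sum_ne_zero (s := univ)
      (f := fun x => ∑ w, p x w) (by omega)
    obtain ⟨w, -, hw⟩ := exists_ne_zero_of_sum_ne_zero (s := univ) (f := p x) hx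
    have hpx : p x w ≤ m x v := (single_le_sum (f := fun w => p x w) (fun _ _ => Nat.zero_le _)
      (mem_univ w)).trans (hrow x)
    have hpw : p x w ≤ m v w := (single_le_sum (f := fun x => p x w) (fun _ _ => Nat.zero_le _)
      (mem_univ x)).trans (hcol w)
    have hxv : x ≠ v := by rintro rfl; omega
    have hwv : w ≠ v := by rintro rfl; omega
    set p' : V → V → ℕ := fun i j => p i j - if i = x ∧ j = w then 1 else 0 with hp'
    have hpp : ∀ i j, p i j = p' i j + if i = x ∧ j = w then 1 else 0 := by
      intro i j; simp only [hp']; split_ifs with h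
      · rw [h.1, h.2]; omega
      · rfl
    have hr : ∀ i, ∑ j, p i j = ∑ j, p' i j + if i = x then 1 else 0 := by
      intro i; simp_rw [hpp, sum_add_distrib]; congr 1
      by_cases h : i = x <;> simp [h]
    have hc : ∀ j, ∑ i, p i j = ∑ i, p' i j + if j = w then 1 else 0 := by
      intro j; simp_rw [hpp, sum_add_distrib]; congr 1
      by_cases h : j = w <;> simp [h]
    have hn : ∑ i, ∑ j, p' i j = n := by
      simp_rw [hr, sum_add_distrib] at hn₀
      simp at hn₀; omega
    by_cases hxw : x = w
    · have := ih h hv p' (fun i => by have := hr i; have := hrow i; omega)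
        (fun i => by have := hc i; have := hcol i; omega) hn
      refine this.mono fun i j => ?_
      have := hpp i j
      unfold _root_.bypass; split_ifs <;> grind
    · have := ih (h.split hxv hwv.symm hxw (by omega) (by omega)) (by grind) p' (fun i => ?_)
        (fun i => ?_) hn
      · refine this.mono fun i j => ?_
        have := hpp i j
        unfold _root_.bypass; grind
      · have := hr i; have := hrow i
        grind
      · have := hc i; have := hcol i
        grind

/-- Keep copy 0 of each bundle inside U and extract a simple path from its connection. -/
theorem IsRouted.exists_immerses (h : IsRouted G m) (U : Finset V) :
    ∃ H : Digraph (Fin #U), H.Loopless ∧ G.Immerses H ∧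
      #{e ∈ U ×ˢ U | e.1 ≠ e.2 ∧ 1 ≤ m e.1 e.2} ≤ H.edgeSet.ncard := by
  obtain ⟨P, hP, hd⟩ := h
  let f := U.equivFin.symm
  let H : Digraph (Fin #U) := ⟨fun i j => i ≠ j ∧ 1 ≤ m (f i) (f j)⟩
  have hpath : ∀ e : Fin #U × Fin #U, ∃ l : List V, 1 ≤ m (f e.1) (f e.2) →
      l.IsChain (fun a b => (a, b) ∈ P (f e.1) (f e.2) 0) ∧ l.Nodup ∧
      l.head? = some (f e.1 : V) ∧ l.getLast? = some (f e.2 : V) := by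
    intro e
    by_cases he : 1 ≤ m (f e.1) (f e.2)
    · obtain ⟨l, hl⟩ := exists_nodup_path_of_reflTransGen (hP _ _ 0 he).2
      exact ⟨l, fun _ => hl⟩
    · exact ⟨[], fun h => absurd h he⟩
  choose l hl using hpath
  have hinj : Function.Injective fun i => (f i : V) := Subtype.val_injective.comp f.injective
  refine ⟨H, fun i hi => hi.1 rfl, ⟨fun i => f i, l, hinj, ?_, ?_⟩, ?_⟩
  · intro e he
    obtain ⟨h1, h2, h3, h4⟩ := hl e he.2
    exact ⟨h1.imp fun a b hab => (hP _ _ 0 he.2).1 hab, h2, h3, h4⟩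
  · intro e he e' he' hne a ha ha'
    have h1 := rel_of_mem_pathEdges (hl e he.2).1 ha
    have h2 := rel_of_mem_pathEdges (hl e' he'.2).1 ha'
    refine Set.disjoint_left.1 (hd _ _ 0 _ _ 0 he.2 he'.2 ?_) h1 h2
    intro heq
    simp only [Prod.mk.injEq, and_true] at heq
    exact hne (Prod.ext (hinj heq.1) (hinj heq.2))
  · rw [← Set.ncard_coe_finset]
    rw [← Set.ncard_image_of_injective H.edgeSet (hinj.prodMap hinj)]
    refine Set.ncard_le_ncard ?_ (Set.toFinite _)
    rintro ⟨x, y⟩ hxy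
    simp only [coe_filter, mem_product, Set.mem_ofPred_eq] at hxy
    obtain ⟨⟨hx, hy⟩, hne, h1⟩ := hxy
    refine ⟨(f.symm ⟨x, hx⟩, f.symm ⟨y, hy⟩), ⟨?_, ?_⟩, by simp⟩
    · simpa using hne
    · simpa using h1

end Routing

/-! ### Local sparsity, shortcuts and regularization -/

section Regularization

open Finset Digraph
open scoped Classical

variable {V : Type*} [Fintype V]

/-- The pairs `(x, w)` such that `x → v → w` and `x → w`. -/
noncomputable def shortcuts (m : V → V → ℕ) (v : V) : Finset (V × V) :=
  {e | 1 ≤ m e.1 v ∧ 1 ≤ m v e.2 ∧ 1 ≤ m e.1 e.2}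

theorem card_support_le_sum (f : V → ℕ) : #{x | 1 ≤ f x} ≤ ∑ x, f x := by
  rw [card_filter]
  exact sum_le_sum fun x _ => by split_ifs <;> omega

/-- In a locally sparse multigraph, few vertices have many shortcuts. -/
theorem card_many_shortcuts_le {m : V → V → ℕ} {d c N : ℕ}
    (hdiag : ∀ x, m x x = 0) (hrow : ∀ x, ∑ w, m x w ≤ d) (hcol : ∀ w, ∑ x, m x w ≤ d)
    (hsparse : ∀ U : Finset V, #U ≤ 2 * d * N →
      #{e ∈ U ×ˢ U | e.1 ≠ e.2 ∧ 1 ≤ m e.1 e.2} < N * c) :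
    #{v | 2 * c ≤ #(shortcuts m v)} * c ≤ 2 * d * N * d * d := by
  have hout : ∀ x, #{w | 1 ≤ m x w} ≤ d := fun x => (card_support_le_sum _).trans (hrow x)
  have hin : ∀ w, #{x | 1 ≤ m x w} ≤ d := fun w => (card_support_le_sum _).trans (hcol w)
  let E : Finset V → Finset (V × V) := fun S => S.biUnion (shortcuts m)
  let U : Finset V → Finset V := fun S =>
    S.biUnion fun v => ({x | 1 ≤ m x v} : Finset V) ∪ ({w | 1 ≤ m v w} : Finset V)
  have hU : ∀ S, #(U S) ≤ 2 * d * #S := by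
    intro S
    refine card_biUnion_le.trans ?_
    calc _ ≤ ∑ _v ∈ S, 2 * d := sum_le_sum fun v _ => (card_union_le _ _).trans (by
          have := hin v; have := hout v; omega)
      _ = _ := by simp [mul_comm]
  have hE : ∀ S, E S ⊆ {e ∈ U S ×ˢ U S | e.1 ≠ e.2 ∧ 1 ≤ m e.1 e.2} := by
    intro S e he
    simp only [E, mem_biUnion, shortcuts, mem_filter, mem_univ, true_and] at he
    obtain ⟨v, hv, h1, h2, h3⟩ := he
    simp only [U, mem_filter, mem_product, mem_biUnion, mem_union, mem_univ, true_and]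
    refine ⟨⟨⟨v, hv, .inl h1⟩, ⟨v, hv, .inr h2⟩⟩, fun h => ?_, h3⟩
    rw [h, hdiag] at h3; omega
  -- A largest S of size at most N whose shortcuts number at least c per vertex. Sparsity on `U S`
  -- keeps it below N, so by maximality no vertex brings c new shortcuts.
  obtain ⟨S, ⟨hS1, hS2⟩, hmax⟩ := exists_minimalFor_of_wellFoundedLT
    (fun S : Finset V => #S ≤ N ∧ #S * c ≤ #(E S)) (fun S => N - #S) ⟨∅, by simp⟩
  have hSN : #S < N := by
    refine lt_of_le_of_ne hS1 fun h => ?_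
    have h1 := hsparse (U S) (h ▸ hU S)
    have h2 := card_le_card (hE S)
    rw [h] at hS2
    omega
  have hbad : ∀ v, 2 * c ≤ #(shortcuts m v) → c ≤ #(shortcuts m v ∩ E S) := by
    intro v hv
    by_cases hvS : v ∈ S
    · have : shortcuts m v ⊆ E S := fun e he => mem_biUnion.2 ⟨v, hvS, he⟩
      rw [inter_eq_left.2 this]; omega
    · by_contra hlt
      have h1 : #(E (insert v S)) = #(shortcuts m v \ E S) + #(E S) := by
        simp only [E]
        rw [biUnion_insert, ← sdiff_union_self_eq_union, card_union_of_disjoint sdiff_disjoint]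
      have h2 := card_sdiff_add_card_inter (shortcuts m v) (E S)
      have h3 : #(insert v S) = #S + 1 := card_insert_of_notMem hvS
      have h4 : (#S + 1) * c = #S * c + c := by ring
      have := hmax (j := insert v S) ⟨by omega, by rw [h3]; omega⟩ (by simp only; omega)
      simp only at this
      omega
  -- A shortcut of v in `E S` starts at an in-neighbour of v in `U S`. Summed over v, there are at
  -- most d * #(U S) such incidences.
  have hcount : ∀ v, #(shortcuts m v ∩ E S) ≤ #{x ∈ U S | 1 ≤ m x v} * d := by
    intro v
    refine le_trans ?_ (Nat.mul_le_mul_left _ (hout v))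
    rw [← card_product]
    refine card_le_card fun e he => ?_
    rw [mem_inter] at he
    have h1 := hE S he.2
    have h2 := he.1
    simp only [shortcuts, mem_filter, mem_product, mem_univ, true_and] at h1 h2 ⊢
    exact ⟨⟨h1.1.1, h2.1⟩, h2.2.1⟩
  calc #{v | 2 * c ≤ #(shortcuts m v)} * c
      = ∑ v with 2 * c ≤ #(shortcuts m v), c := by simp
    _ ≤ ∑ v with 2 * c ≤ #(shortcuts m v), #{x ∈ U S | 1 ≤ m x v} * d :=
        sum_le_sum fun v hv => (hbad v (mem_filter.1 hv).2).trans (hcount v)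
    _ ≤ ∑ v, #{x ∈ U S | 1 ≤ m x v} * d := sum_le_sum_of_subset (filter_subset _ _)
    _ = (∑ x ∈ U S, #{v | 1 ≤ m x v}) * d := by
        rw [← sum_mul]
        simp_rw [card_filter]
        rw [sum_comm]
    _ ≤ (∑ _x ∈ U S, d) * d := by gcongr; exact hout _
    _ ≤ 2 * d * N * d * d := by
        rw [sum_const, smul_eq_mul]
        gcongr
        exact (hU S).trans (by gcongr)

/-- A locally sparse Eulerian digraph of large minimum degree routes a regular digraph. -/
theorem exists_regular_isRouted {G : Digraph V} (hloop : G.Loopless) (heul : G.IsEulerian)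
    {d s T B : ℕ} (hdeg : ∀ v, d ≤ G.outDegree v) (hsd : s ≤ d) (hT : T + s ≤ s * s)
    (hB : 2 * s ≤ B)
    (hsparse : ∀ m, IsRouted G m → ∀ U : Finset V, #U ≤ B →
      #{e ∈ U ×ˢ U | e.1 ≠ e.2 ∧ 1 ≤ m e.1 e.2} < T) :
    ∃ m, IsRouted G m ∧ (∀ x y, m x y ≤ 1) ∧ (∀ x, m x x = 0) ∧ (∀ x, ∑ w, m x w = d) ∧
      ∀ w, ∑ x, m x w = d := by
  let good : (V → V → ℕ) → Prop := fun m => IsRouted G m ∧ (∀ x y, m x y ≤ 1) ∧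
    (∀ x, m x x = 0) ∧ (∀ x, ∑ w, m x w = ∑ w, m w x) ∧ ∀ x, d ≤ ∑ w, m x w
  have hout : ∀ x, ∑ w, (if G.Adj x w then 1 else 0) = G.outDegree x := by
    intro x
    rw [← card_filter, outDegree, Set.ncard_eq_toFinset_card']
    congr 1; ext; simp
  have hin : ∀ x, ∑ w, (if G.Adj w x then 1 else 0) = G.inDegree x := by
    intro x
    rw [← card_filter, inDegree, Set.ncard_eq_toFinset_card']
    congr 1; ext; simp
  obtain ⟨m, ⟨hm, hm1, hm0, hbal, hge⟩, hmin⟩ := exists_minimalFor_of_wellFoundedLT good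
    (fun m => ∑ x, ∑ y, m x y) ⟨_, isRouted_adj G, fun x y => by split_ifs <;> simp,
      fun x => if_neg (hloop x), fun x => by rw [hout, hin, heul x],
      fun x => by rw [hout]; exact hdeg x⟩
  have hreg : ∀ x, ∑ w, m x w = d := by
    intro x
    refine le_antisymm ?_ (hge x)
    by_contra hlt
    rw [not_le] at hlt
    have hcard : ∀ f : V → ℕ, (∀ y, f y ≤ 1) → #{y | 1 ≤ f y} = ∑ y, f y := by
      intro f hf
      rw [card_filter]
      exact sum_congr rfl fun y _ => by have := hf y; split_ifs <;> omega
    have hA := hcard (fun u => m u x) (fun u => hm1 u x)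
    have hB' := hcard (fun w => m x w) (fun w => hm1 x w)
    have hbx := hbal x
    -- If every splitting at x would create a parallel edge, s in-neighbours and s out-neighbours of
    -- x span at least s * s - s adjacent pairs. Otherwise a splitting lowers the total.
    by_cases hfull : ∀ u w, 1 ≤ m u x → 1 ≤ m x w → u ≠ w → 1 ≤ m u w
    · obtain ⟨A, hA1, hA2⟩ := exists_subset_card_eq (s := ({u | 1 ≤ m u x} : Finset V))
        (n := s) (by omega)
      obtain ⟨C, hC1, hC2⟩ := exists_subset_card_eq (s := ({w | 1 ≤ m x w} : Finset V))
        (n := s) (by omega)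
      have h1 := hsparse m hm (A ∪ C) ((card_union_le _ _).trans (by omega))
      have h2 : A ×ˢ C \ A.image (fun x => (x, x)) ⊆
          {e ∈ (A ∪ C) ×ˢ (A ∪ C) | e.1 ≠ e.2 ∧ 1 ≤ m e.1 e.2} := by
        rintro ⟨u, w⟩ he
        simp only [mem_sdiff, mem_product, mem_image, Prod.mk.injEq, not_exists, not_and] at he
        obtain ⟨⟨hu, hw⟩, hne⟩ := he
        have hne' : u ≠ w := fun h => hne u hu rfl h
        have hu' := hA1 hu
        have hw' := hC1 hw
        simp only [mem_filter, mem_univ, true_and] at hu' hw'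
        simp only [mem_filter, mem_product, mem_union]
        exact ⟨⟨.inl hu, .inr hw⟩, hne', hfull u w hu' hw' hne'⟩
      have h3 := card_le_card h2
      have h4 := le_card_sdiff (A.image fun x => (x, x)) (A ×ˢ C)
      have h5 : #(A.image fun x => (x, x)) ≤ #A := card_image_le
      rw [card_product, hA2, hC2] at h4
      omega
    · push Not at hfull
      obtain ⟨u, w, hu, hw, huw, h0⟩ := hfull
      have hux : u ≠ x := by rintro rfl; rw [hm0] at hu; omega
      have hxw : x ≠ w := by rintro rfl; rw [hm0] at hw; omega
      have hsplit := hm.split hux hxw huw hu hw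
      set m' : V → V → ℕ := fun a b => if a = u ∧ b = w then m u w + 1 else
        if a = u ∧ b = x then m u x - 1 else if a = x ∧ b = w then m x w - 1 else m a b with hm'
      have key : ∀ a b, m' a b + ((if a = u ∧ b = x then 1 else 0) +
          if a = x ∧ b = w then 1 else 0) = m a b + if a = u ∧ b = w then 1 else 0 := by
        intro a b
        simp only [hm']
        split_ifs <;> grind
      have hrow : ∀ a, ∑ b, m' a b + (if a = x then 1 else 0) = ∑ b, m a b := by
        intro a
        have := Finset.sum_congr (rfl : (univ : Finset V) = univ) (fun b _ => key a b)
        simp only [sum_add_distrib] at this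
        by_cases h1 : a = u <;> by_cases h2 : a = x <;> simp_all
      have hcol : ∀ b, ∑ a, m' a b + (if b = x then 1 else 0) = ∑ a, m a b := by
        intro b
        have := Finset.sum_congr (rfl : (univ : Finset V) = univ) (fun a _ => key a b)
        simp only [sum_add_distrib] at this
        by_cases h1 : b = w <;> by_cases h2 : b = x <;> simp_all
      have htot : ∑ a, ∑ b, m' a b + 1 = ∑ a, ∑ b, m a b := by
        simp_rw [← hrow, sum_add_distrib]; simp
      have := hmin (j := m') ⟨hsplit, fun a b => ?_, fun a => ?_, fun a => ?_, fun a => ?_⟩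
        (by simp only; omega)
      · simp only at this; omega
      · have := hm1 a b
        simp only [hm']; split_ifs <;> grind
      · have := hm0 a
        simp only [hm']; split_ifs <;> grind
      · have h1 := hrow a
        have h2 := hcol a
        have h3 := hbal a
        omega
      · have h1 := hrow a
        have h2 := hge a
        by_cases hax : a = x
        · subst hax; simp only [if_true] at h1; omega
        · simp only [hax, if_false] at h1; omega
  exact ⟨m, hm, hm1, hm0, hreg, fun w => by rw [← hbal, hreg]⟩

end Regularization

/-! ### Stages, potential and deletion of a vertex -/

section Reduction

open Finset Digraph
open scoped Classical

variable {V : Type*} {G : Digraph V} {d K : ℕ} {S : Finset V} {m : V → V → ℕ}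

/-- The penalty for a vertex of degree `D`. -/
def deficitCost (d K D : ℕ) : ℕ := 100 * (d - D) + if D < d then 2 * K else 0

theorem bypass_transpose (m p : V → V → ℕ) (v x y : V) :
    bypass (fun i j => m j i) v (fun i j => p j i) x y = bypass m v p y x := by
  unfold bypass; simp [or_comm, eq_comm]

/-- The multigraph `m` with the edges at `v` removed. -/
noncomputable def isolate (m : V → V → ℕ) (v : V) : V → V → ℕ := fun x y =>
  if x = v ∨ y = v then 0 else m x y

theorem isolate_transpose (m : V → V → ℕ) (v x y : V) :
    isolate (fun i j => m j i) v x y = isolate m v y x := by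
  unfold isolate; simp [or_comm]

variable [Fintype V]

/-- A routed Eulerian multigraph on `S` without loops and of maximum degree at most `d`. -/
structure IsStage (G : Digraph V) (d : ℕ) (S : Finset V) (m : V → V → ℕ) : Prop where
  routed : IsRouted G m
  diag : ∀ x, m x x = 0
  bal : ∀ x, ∑ w, m x w = ∑ w, m w x
  le : ∀ x, ∑ w, m x w ≤ d
  supp : ∀ x y, m x y ≠ 0 → x ∈ S ∧ y ∈ S

/-- The distance of a multigraph from a simple `d`-regular digraph. -/
noncomputable def potential (d K : ℕ) (S : Finset V) (m : V → V → ℕ) : ℕ :=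
  ∑ x, ∑ y, bundleWeight (m x y) + ∑ x ∈ S, deficitCost d K (∑ w, m x w)

/-- The weight of the bundles at `v`. -/
noncomputable def gain (m : V → V → ℕ) (v : V) : ℕ :=
  ∑ x, bundleWeight (m x v) + ∑ x, bundleWeight (m v x)

theorem bundleWeight_zero : bundleWeight 0 = 0 := rfl

theorem bundleWeight_mono : Monotone bundleWeight := fun a b h => by
  unfold bundleWeight; omega

/-- The linear part of the penalty matches the price 100 of a loop; the jump 2K is paid only where
the degree drops. -/
theorem deficitCost_le (d K D l : ℕ) :
    deficitCost d K (D - l) ≤ deficitCost d K D + 100 * l + if l ≠ 0 then 2 * K else 0 := by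
  unfold deficitCost
  by_cases h : l = 0
  · simp [h]
  · simp only [ne_eq, h, not_false_eq_true, if_true]
    split_ifs <;> omega

theorem isolate_sum_row (m : V → V → ℕ) {v x : V} (hx : x ≠ v) :
    ∑ w, isolate m v x w + m x v = ∑ w, m x w := by
  have : ∀ w, m x w = isolate m v x w + if w = v then m x v else 0 := by
    intro w; unfold isolate; by_cases h : w = v <;> simp [h, hx]
  rw [sum_congr rfl fun w _ => this w, sum_add_distrib]
  simp

theorem IsStage.row_le (h : IsStage G d S m) (v x : V) : ∑ w, isolate m v x w + m x v ≤ d := by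
  by_cases hx : x = v
  · subst hx; simp [isolate, h.diag]
  · rw [isolate_sum_row m hx]; exact h.le x

theorem IsStage.col_le (h : IsStage G d S m) (v x : V) : ∑ w, isolate m v w x + m v x ≤ d := by
  by_cases hx : x = v
  · subst hx; simp [isolate, h.diag]
  · have := isolate_sum_row (fun i j => m j i) hx
    simp_rw [isolate_transpose] at this
    rw [this, ← h.bal]; exact h.le x

theorem sum_bypass_row {m p : V → V → ℕ} {v x : V} (hx : x ≠ v)
    (hrow : ∑ w, p x w = m x v) (hv : p x v = 0) :
    ∑ w, bypass m v p x w + p x x = ∑ w, m x w := by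
  have h1 : ∀ w, bypass m v p x w + (if w = x then p x x else 0) = isolate m v x w + p x w := by
    intro w
    unfold bypass isolate
    by_cases h2 : w = v
    · subst h2; simp [hx.symm, hv]
    · by_cases h3 : w = x
      · subst h3; simp [hx]
      · simp [hx, h2, h3, Ne.symm h3]
  have h2 := sum_congr (rfl : (univ : Finset V) = univ) fun w _ => h1 w
  simp only [sum_add_distrib, sum_ite_eq', mem_univ, if_true, hrow] at h2
  rw [h2, isolate_sum_row m hx]

/-- The effect on the potential of removing a vertex with an optimal transport. -/
theorem IsStage.remove (h : IsStage G d S m) {v : V} (hv : v ∈ S) {p : V → V → ℕ}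
    (hp : IsOptimalTransport (fun x => m x v) (m v) (isolate m v) p) :
    IsStage G d (S.erase v) (bypass m v p) ∧
    potential d K (S.erase v) (bypass m v p) + gain m v + deficitCost d K (∑ w, m v w) ≤
      potential d K S m + transportCost (insertionCost (isolate m v)) p +
        (if ∀ x, p x x = 0 then 0 else 2 * K) := by
  have hpr : ∀ w, p v w = 0 := fun w => by
    have := hp.isTransport.le_row v w; simp only [h.diag] at this; omega
  have hpc : ∀ x, p x v = 0 := fun x => by
    have := hp.isTransport.le_col x v; rw [h.diag] at this; omega
  have hrow : ∀ x, x ≠ v → ∑ w, bypass m v p x w + p x x = ∑ w, m x w := fun x hx =>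
    sum_bypass_row hx (hp.isTransport.row x) (hpc x)
  have hcol : ∀ x, x ≠ v → ∑ w, bypass m v p w x + p x x = ∑ w, m w x := fun x hx => by
    have := sum_bypass_row (m := fun i j => m j i) (p := fun i j => p j i) hx
      (hp.isTransport.col x) (hpr x)
    simp_rw [bypass_transpose] at this
    exact this
  refine ⟨⟨h.routed.bypass (h.diag v) p (fun x => (hp.isTransport.row x).le)
    (fun x => (hp.isTransport.col x).le), fun x => ?_, fun x => ?_, fun x => ?_,
    fun x y hxy => ?_⟩, ?_⟩
  · simp [bypass, h.diag]
  · by_cases hx : x = v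
    · subst hx; simp [bypass]
    · have h1 := hrow x hx
      have h2 := hcol x hx
      have h3 := h.bal x
      omega
  · by_cases hx : x = v
    · subst hx; simp [bypass]
    · have h1 := hrow x hx
      have h3 := h.le x
      omega
  · unfold bypass at hxy
    split_ifs at hxy with h1 h2
    · exact absurd rfl hxy
    · rw [h2, h.diag] at hxy; omega
    · rw [not_or] at h1
      simp only [mem_erase]
      by_cases h3 : m x y = 0
      · have h4 := hp.isTransport.le_row x y
        have h5 := hp.isTransport.le_col x y
        exact ⟨⟨h1.1, (h.supp x v (by omega)).1⟩, ⟨h1.2, (h.supp v y (by omega)).2⟩⟩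
      · exact ⟨⟨h1.1, (h.supp x y h3).1⟩, ⟨h1.2, (h.supp x y h3).2⟩⟩
  -- Loops are priced in the transport but absent from the bypass, so 100 per loop remains to pay
  -- for the lost degree.
  have hw : ∑ x, ∑ y, bundleWeight (bypass m v p x y) + 100 * ∑ x, p x x =
      ∑ x, ∑ y, bundleWeight (isolate m v x y) +
        transportCost (insertionCost (isolate m v)) p := by
    have : 100 * ∑ x, p x x = ∑ x, ∑ y, if x = y then 100 * p x x else 0 := by
      rw [mul_sum]; simp
    rw [this, transportCost, ← sum_add_distrib, ← sum_add_distrib]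
    refine sum_congr rfl fun x _ => ?_
    rw [← sum_add_distrib, ← sum_add_distrib]
    refine sum_congr rfl fun y _ => ?_
    by_cases hxy : x = y
    · subst hxy; simp [insertionCost, bypass, isolate, h.diag, bundleWeight_zero]
    · have hmono := bundleWeight_mono (Nat.le_add_right (isolate m v x y) (p x y))
      have : bypass m v p x y = isolate m v x y + p x y := by
        unfold bypass isolate
        by_cases hx : x = v
        · subst hx; simp [hpr]
        · by_cases hy : y = v
          · subst hy; simp [hpc]
          · simp [hx, hy, hxy]
      simp only [insertionCost, if_neg hxy, this]
      omega
  have hg : ∑ x, ∑ y, bundleWeight (m x y) =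
      ∑ x, ∑ y, bundleWeight (isolate m v x y) + gain m v := by
    have e1 : ∑ x, bundleWeight (m x v) = ∑ x, ∑ y, if y = v then bundleWeight (m x v) else 0 := by
      simp
    have e2 : ∑ y, bundleWeight (m v y) = ∑ x, ∑ y, if x = v then bundleWeight (m v y) else 0 := by
      rw [sum_comm]; simp
    rw [gain, e1, e2, ← sum_add_distrib, ← sum_add_distrib]
    refine sum_congr rfl fun x _ => ?_
    rw [← sum_add_distrib, ← sum_add_distrib]
    refine sum_congr rfl fun y _ => ?_
    unfold isolate
    by_cases hx : x = v <;> by_cases hy : y = v <;> simp [hx, hy, h.diag, bundleWeight_zero]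
  -- All loops of an optimal transport sit at one vertex, so only one jump is paid.
  have hl : ∑ x, (if p x x ≠ 0 then 2 * K else 0) ≤ if ∀ x, p x x = 0 then 0 else 2 * K := by
    split_ifs with hz
    · simp [hz]
    · push Not at hz
      obtain ⟨y, hy⟩ := hz
      rw [sum_eq_single y]
      · simp [hy]
      · intro z _ hzy
        rw [if_neg]
        exact fun hz => hzy (hp.loop_unique hz hy)
      · simp
  have hdef : ∑ x ∈ S.erase v, deficitCost d K (∑ w, bypass m v p x w) ≤
      ∑ x ∈ S.erase v, deficitCost d K (∑ w, m x w) + 100 * ∑ x, p x x +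
        if ∀ x, p x x = 0 then 0 else 2 * K := by
    calc _ ≤ ∑ x ∈ S.erase v, (deficitCost d K (∑ w, m x w) + 100 * p x x +
          if p x x ≠ 0 then 2 * K else 0) := by
          refine sum_le_sum fun x hx => ?_
          have h1 := hrow x (mem_erase.1 hx).1
          have h2 : ∑ w, bypass m v p x w = ∑ w, m x w - p x x := by omega
          rw [h2]
          exact deficitCost_le _ _ _ _
      _ ≤ _ := by
          rw [sum_add_distrib, sum_add_distrib, mul_sum]
          refine Nat.add_le_add (Nat.add_le_add_left ?_ _) (le_trans ?_ hl)
          · exact sum_le_sum_of_subset (subset_univ _)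
          · exact sum_le_sum_of_subset (subset_univ _)
  have hS := sum_erase_add S (fun x => deficitCost d K (∑ w, m x w)) hv
  unfold potential
  omega

end Reduction

/-! ### Choosing the vertex to delete, and conclusion -/

section Main

open Finset Digraph
open scoped Classical

section Step

variable {V : Type*} [Fintype V] {G : Digraph V} {d L : ℕ} {S : Finset V} {m : V → V → ℕ}

/-- A blocked pair is a shortcut or lies on the diagonal over an in-neighbour of v. -/
theorem IsStage.blockedPairs_le (h : IsStage G d S m) (v : V) :
    blockedPairs (fun x => m x v) (m v) (isolate m v) ≤ #(shortcuts m v) + d := by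
  have h1 : #(({x | 1 ≤ m x v} : Finset V).image fun x => (x, x)) ≤ d :=
    card_image_le.trans ((card_support_le_sum _).trans (by rw [← h.bal]; exact h.le v))
  refine le_trans ?_ (Nat.add_le_add_left h1 _)
  refine le_trans (card_le_card ?_) (card_union_le _ _)
  rintro ⟨x, w⟩ he
  simp only [mem_filter, mem_univ, true_and] at he
  obtain ⟨hx, hw, h2⟩ := he
  simp only [mem_union, shortcuts, mem_filter, mem_univ, true_and, mem_image, Prod.mk.injEq]
  by_cases hxw : x = w
  · exact .inr ⟨x, hx, rfl, hxw⟩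
  · refine .inl ⟨hx, hw, ?_⟩
    have h3 := h2.resolve_left hxw
    unfold isolate at h3
    split_ifs at h3
    · omega
    · exact h3

theorem bundleWeight_le (n : ℕ) : bundleWeight n ≤ 100 * n := by
  unfold bundleWeight; omega

theorem IsStage.gain_le (h : IsStage G d S m) (v : V) : gain m v ≤ 200 * d := by
  have h1 : ∑ x, bundleWeight (m x v) ≤ 100 * ∑ x, m x v := by
    rw [mul_sum]; exact sum_le_sum fun x _ => bundleWeight_le _
  have h2 : ∑ x, bundleWeight (m v x) ≤ 100 * ∑ x, m v x := by
    rw [mul_sum]; exact sum_le_sum fun x _ => bundleWeight_le _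
  have h3 := h.bal v
  have h4 := h.le v
  unfold gain; omega

theorem IsStage.gain_eq_zero (h : IsStage G d S m) {v : V} (hv : v ∉ S) : gain m v = 0 := by
  have h1 : ∀ x, m x v = 0 := fun x => by by_contra hx; exact hv (h.supp x v hx).2
  have h2 : ∀ x, m v x = 0 := fun x => by by_contra hx; exact hv (h.supp v x hx).1
  simp [gain, h1, h2, bundleWeight_zero]

theorem sum_gain (m : V → V → ℕ) : ∑ v, gain m v = 2 * ∑ x, ∑ y, bundleWeight (m x y) := by
  simp_rw [gain, sum_add_distrib]
  rw [sum_comm]; omega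

/-- Removing a vertex with few shortcuts. -/
theorem IsStage.remove_of_shortcuts (h : IsStage G d S m) (hL : 1 ≤ L)
    (hd : d = 10000000000000 * L) {v : V} (hv : v ∈ S)
    (hsc : #(shortcuts m v) ≤ 10000000000000 * (L * L)) :
    ∃ m', IsStage G d (S.erase v) m' ∧
      (potential d (10000000000 * L) (S.erase v) m' + 10000000000 * L ≤
          potential d (10000000000 * L) S m ∨
      99 * potential d (10000000000 * L) (S.erase v) m' + 97 * gain m v +
          99 * deficitCost d (10000000000 * L) (∑ w, m v w) ≤
        99 * potential d (10000000000 * L) S m + 99 * (19200 * L)) := by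
  obtain ⟨p, hp⟩ := exists_isOptimalTransport (a := fun x => m x v) (b := m v) (isolate m v)
    (h.bal v).symm
  obtain ⟨hst, hpot⟩ := h.remove (K := 10000000000 * L) hv hp
  refine ⟨_, hst, ?_⟩
  have hD := h.le v
  by_cases hsmall : d ≤ 3 * ∑ w, m v w
  · have hN := h.blockedPairs_le v
    have hLL : L ≤ L * L := Nat.le_mul_self L
    rcases hp.cost_dichotomy hL hd (h.bal v).symm rfl (h.row_le v) (h.col_le v)
      (by omega) hsmall with hc | ⟨hz, hc⟩
    -- The saving of 3K covers a possible jump 2K and leaves K.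
    · left
      have : gain m v = ∑ x, bundleWeight (m x v) + ∑ x, bundleWeight (m v x) := rfl
      split_ifs at hpot <;> omega
    · right
      rw [if_pos hz] at hpot
      -- Hence twice the surplus costs at most 2/99 of the gain, and 97/99 of it is kept.
      have h1 : 99 * (surplus (fun x => m x v) + surplus (m v)) ≤ gain m v := by
        rw [gain, sum_bundleWeight, sum_bundleWeight]; omega
      omega
  -- For degree D < d / 3 the penalty 100 (d - D) + 2K is refunded, while rerouting costs at most
  -- 100 D + 2K.
  · left
    have hmax : transportCost (insertionCost (isolate m v)) p ≤ 100 * ∑ w, m v w := by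
      calc _ ≤ ∑ x, ∑ w, 100 * p x w :=
            sum_le_sum fun x _ => sum_le_sum fun w _ => insertionCost_le _ _ _ _
        _ = _ := by simp_rw [← mul_sum, hp.isTransport.row, h.bal v]
    unfold deficitCost at hpot
    split_ifs at hpot <;> omega

/-- A stage on many vertices, few of which have many shortcuts, can be reduced. -/
theorem IsStage.exists_reduction (h : IsStage G d S m) (hL : 1 ≤ L)
    (hd : d = 10000000000000 * L)
    (hpot : potential d (10000000000 * L) S m ≤ 10000000000 * L * #S)
    (hbad : #{v | 10000000000000 * (L * L) ≤ #(shortcuts m v)} ≤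
      1600000000000000000000000000000000000 * L)
    (hS : 100000000000000000000000000000000000000000000000000 * L ≤ #S) :
    ∃ v ∈ S, ∃ m', IsStage G d (S.erase v) m' ∧
      potential d (10000000000 * L) (S.erase v) m' + 10000000000 * L ≤ 10000000000 * L * #S := by
  have hLL : L ≤ L * L := Nat.le_mul_self L
  have hprod := Nat.mul_le_mul_left L hS
  have hbprod := Nat.mul_le_mul_left L hbad
  -- A deficient vertex refunds at least 2K; a gain of 1.9K, of which 97/99 is kept, also exceeds K
  -- plus the error 19200 L.
  by_cases hgood : ∃ v ∈ S, #(shortcuts m v) < 10000000000000 * (L * L) ∧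
      (∑ w, m v w < d ∨ 19000000000 * L ≤ gain m v)
  · obtain ⟨v, hv, hsc, hv'⟩ := hgood
    obtain ⟨m', hm', hpot'⟩ := h.remove_of_shortcuts hL hd hv hsc.le
    refine ⟨v, hv, m', hm', ?_⟩
    rcases hpot' with hpot' | hpot'
    · omega
    · rcases hv' with hv' | hv'
      · have : 20000000000 * L ≤ deficitCost d (10000000000 * L) (∑ w, m v w) := by
          unfold deficitCost; rw [if_pos hv']; omega
        omega
      · omega
  -- Otherwise only Q carries deficits or gains of 1.9K or more. Since gains count every bundle
  -- twice, the potential is at most 0.95 K #S plus a term in #Q, and this slack pays for any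
  -- deletion outside Q.
  push Not at hgood
  set Q : Finset V := {v | 10000000000000 * (L * L) ≤ #(shortcuts m v)}
  have hQ : ∀ v, v ∉ Q ↔ #(shortcuts m v) < 10000000000000 * (L * L) := by simp [Q]
  obtain ⟨v, hvS, hvQ⟩ := exists_mem_notMem_of_card_lt_card (s := Q) (t := S) (by omega)
  obtain ⟨m', hm', hpot'⟩ := h.remove_of_shortcuts hL hd hvS ((hQ v).1 hvQ).le
  refine ⟨v, hvS, m', hm', ?_⟩
  rcases hpot' with hpot' | hpot'
  · omega
  have hgain : ∑ v, gain m v ≤ 19000000000 * L * #S + 200 * d * #Q := by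
    calc ∑ v, gain m v ≤ ∑ v, ((if v ∈ S then 19000000000 * L else 0) +
          if v ∈ Q then 200 * d else 0) := by
          refine sum_le_sum fun v _ => ?_
          by_cases hvQ : v ∈ Q
          · rw [if_pos hvQ]
            exact (h.gain_le v).trans (Nat.le_add_left _ _)
          · by_cases hvS : v ∈ S
            · rw [if_pos hvS]
              exact (hgood v hvS ((hQ v).1 hvQ)).2.le.trans (Nat.le_add_right _ _)
            · rw [h.gain_eq_zero hvS]; exact Nat.zero_le _
      _ = _ := by
          rw [sum_add_distrib, sum_univ_ite_mem, sum_univ_ite_mem]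
          simp only [sum_const, smul_eq_mul]; ring
  have hdef : ∑ v ∈ S, deficitCost d (10000000000 * L) (∑ w, m v w) ≤ 101 * d * #Q := by
    calc _ ≤ ∑ v, if v ∈ Q then 101 * d else 0 := by
          refine (sum_le_sum fun v hvS => ?_).trans (sum_le_sum_of_subset (subset_univ S))
          unfold deficitCost
          by_cases hvQ : v ∈ Q
          · rw [if_pos hvQ]; split_ifs <;> omega
          · have h1 := (hgood v hvS ((hQ v).1 hvQ)).1
            have h2 := h.le v
            split_ifs <;> omega
      _ = _ := by
          rw [sum_univ_ite_mem]; simp only [sum_const, smul_eq_mul]; ring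
  have hsum := sum_gain m
  have hpot0 : potential d (10000000000 * L) S m = ∑ x, ∑ y, bundleWeight (m x y) +
    ∑ v ∈ S, deficitCost d (10000000000 * L) (∑ w, m v w) := rfl
  have e1 : 19000000000 * L * #S = 19000000000 * (L * #S) := by ring
  have e2 : 200 * d * #Q = 2000000000000000 * (L * #Q) := by rw [hd]; ring
  have e3 : 101 * d * #Q = 1010000000000000 * (L * #Q) := by rw [hd]; ring
  have e4 : 10000000000 * L * #S = 10000000000 * (L * #S) := by ring
  rw [e1, e2] at hgain
  rw [e3] at hdef
  rw [e4]
  have e5 : L * (100000000000000000000000000000000000000000000000000 * L) =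
    100000000000000000000000000000000000000000000000000 * (L * L) := by ring
  have e6 : L * (1600000000000000000000000000000000000 * L) =
    1600000000000000000000000000000000000 * (L * L) := by ring
  rw [e5] at hprod
  rw [e6] at hbprod
  omega

/-- A stage of small potential has many edges. -/
theorem IsStage.le_card_edges (h : IsStage G d S m) {K : ℕ} (hK : 2 * K ≤ d)
    (hpot : potential d K S m ≤ K * #S) (hS : S.Nonempty) :
    d * d ≤ 4 * #{e ∈ S ×ˢ S | e.1 ≠ e.2 ∧ 1 ≤ m e.1 e.2} := by
  have h1 : #{e ∈ S ×ˢ S | e.1 ≠ e.2 ∧ 1 ≤ m e.1 e.2} =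
      ∑ x, ∑ y, if 1 ≤ m x y then 1 else 0 := by
    rw [← Fintype.sum_prod_type' (f := fun x y => if 1 ≤ m x y then 1 else 0), ← card_filter]
    congr 1
    ext ⟨x, y⟩
    simp only [mem_filter, mem_product, mem_univ, true_and]
    refine ⟨fun h => h.2.2, fun hxy => ⟨h.supp x y (by omega), ?_, hxy⟩⟩
    rintro rfl
    rw [h.diag] at hxy; omega
  have h2 : #{e ∈ S ×ˢ S | e.1 ≠ e.2 ∧ 1 ≤ m e.1 e.2} ≤ #S * #S := by
    rw [← card_product]; exact card_filter_le _ _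
  have h3 : ∑ x, ∑ y, m x y ≤ ∑ x, ∑ y, (if 1 ≤ m x y then 1 else 0) +
      ∑ x, ∑ y, bundleWeight (m x y) := by
    rw [← sum_add_distrib]
    refine sum_le_sum fun x _ => ?_
    rw [← sum_add_distrib]
    refine sum_le_sum fun y _ => ?_
    unfold bundleWeight
    split_ifs <;> omega
  have h4 : #S * d ≤ ∑ x, ∑ y, m x y + ∑ x ∈ S, deficitCost d K (∑ w, m x w) := by
    calc #S * d = ∑ x ∈ S, d := by simp
      _ ≤ ∑ x ∈ S, (∑ y, m x y + deficitCost d K (∑ w, m x w)) :=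
        sum_le_sum fun x _ => by unfold deficitCost; omega
      _ ≤ _ := by
        rw [sum_add_distrib]
        exact Nat.add_le_add_right (sum_le_sum_of_subset (subset_univ S)) _
  unfold potential at hpot
  set e := #{e ∈ S ×ˢ S | e.1 ≠ e.2 ∧ 1 ≤ m e.1 e.2}
  -- The potential bounds all repeated and missing edges by K #S, at most half of d #S. With e ≤ #S
  -- * #S this also forces d ≤ 2 #S.
  have h5 : #S * d ≤ 2 * e := by
    have : 2 * K * #S ≤ d * #S := Nat.mul_le_mul_right _ hK
    nlinarith
  have h6 : 0 < #S := hS.card_pos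
  have h7 : d ≤ 2 * #S := by
    have : #S * d ≤ #S * (2 * #S) := by nlinarith
    exact Nat.le_of_mul_le_mul_left this h6
  nlinarith

end Step

/-- Under the contrary assumption, consider a smallest nonempty S carrying a stage of potential at
most K per vertex: if small it is dense, and if large it can be reduced. -/
theorem exists_dense_routed {V : Type*} [Fintype V] [Nonempty V] {G : Digraph V}
    (hloop : G.Loopless) (heul : G.IsEulerian) {L : ℕ} (hL : 1 ≤ L)
    (hdeg : ∀ v, 10000000000000 * L ≤ G.outDegree v) :
    ∃ m, IsRouted G m ∧ ∃ U : Finset V,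
      #U ≤ 100000000000000000000000000000000000000000000000000 * L ∧
      20000000000000000000000 * (L * L) ≤ #{e ∈ U ×ˢ U | e.1 ≠ e.2 ∧ 1 ≤ m e.1 e.2} := by
  by_contra hcon
  push Not at hcon
  have hLL : L ≤ L * L := Nat.le_mul_self L
  obtain ⟨m₀, hm₀, h1, h0, hr, hc⟩ := exists_regular_isRouted hloop heul
    (s := 1000000000000 * L) hdeg (by omega) (by nlinarith) (by omega) hcon
  let d := 10000000000000 * L
  let K := 10000000000 * L
  obtain ⟨S, ⟨hne, m, hm, hpot⟩, hmin⟩ := exists_minimalFor_of_wellFoundedLT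
    (fun S : Finset V => S.Nonempty ∧ ∃ m, IsStage G d S m ∧ potential d K S m ≤ K * #S)
    (fun S => #S) ⟨univ, univ_nonempty, m₀,
      ⟨hm₀, h0, fun x => by rw [hr, hc], fun x => (hr x).le, fun _ _ _ => by simp⟩, by
        have e1 : ∀ x y, bundleWeight (m₀ x y) = 0 := fun x y => by
          have := h1 x y
          unfold bundleWeight; omega
        simp [potential, e1, hr, deficitCost, d]⟩
  have hlarge : 100000000000000000000000000000000000000000000000000 * L < #S := by
    by_contra hle
    have h2 := hcon m hm.routed S (by omega)
    have h3 := hm.le_card_edges (by omega) hpot hne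
    simp only [d] at h3
    nlinarith
  have hbad : #{v | 10000000000000 * (L * L) ≤ #(shortcuts m v)} ≤
      1600000000000000000000000000000000000 * L := by
    -- N * c is exactly the forbidden 2 * 10^22 L^2, and 2 * d * N = 8 * 10^22 L is within the
    -- allowed 10^50 L vertices.
    have := card_many_shortcuts_le (c := 5000000000000 * (L * L)) (N := 4000000000) hm.diag hm.le
      (fun w => by rw [← hm.bal]; exact hm.le w) (fun U hU => by
        have := hcon m hm.routed U (by omega)
        omega)
    have e : 2 * (5000000000000 * (L * L)) = 10000000000000 * (L * L) := by ring
    rw [e] at this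
    simp only [d] at this
    refine Nat.le_of_mul_le_mul_right (this.trans (le_of_eq ?_))
      (by positivity : 0 < 5000000000000 * (L * L))
    ring
  obtain ⟨v, hv, m', hm', hpot'⟩ := hm.exists_reduction hL rfl hpot hbad hlarge.le
  have hcard := card_erase_add_one hv
  have hlt := hmin (j := S.erase v) ⟨card_pos.1 (by omega), m', hm', by
    rw [← hcard] at hpot'
    simp only [K, d]
    linarith⟩ (by simp only; omega)
  simp only at hlt
  omega

end Main

theorem theorem4p1 :
    ∃ β : ℝ, 0 < β ∧ ∃ k₀ : ℕ, ∀ k : ℕ, k₀ ≤ k →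
      ∀ (V : Type*) [Finite V] [Nonempty V] (D : Digraph V),
        D.Loopless → D.IsEulerian →
        (∀ v, 100 * k ≤ D.inDegree v ∧ 100 * k ≤ D.outDegree v) →
        ∃ (m : ℕ) (H : Digraph (Fin m)),
          H.Loopless ∧ D.Immerses H ∧
          (m : ℝ) ≤ β * k ∧ (k : ℝ) ^ 2 / 2 ≤ (H.edgeSet.ncard : ℝ) := by
  refine ⟨100000000000000000000000000000000000000000000000000, by norm_num, 1000000000000, ?_⟩
  intro k hk V _ _ D hloop heul hdeg
  have := Fintype.ofFinite V
  -- This gives d = 10^13 L ≤ 100 k, while k ≤ 2 * 10^11 L turns 2 * 10^22 L^2 into at least k^2 /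
  -- 2.
  obtain ⟨L, hL⟩ : ∃ L, L = k / 100000000000 := ⟨_, rfl⟩
  have hL1 : 1 ≤ L := by omega
  have hkL : k ≤ 200000000000 * L := by omega
  obtain ⟨m, hm, U, hU, hE⟩ := exists_dense_routed hloop heul hL1 fun v => by
    have := (hdeg v).2; omega
  obtain ⟨H, hH, himm, hcard⟩ := hm.exists_immerses U
  refine ⟨_, H, hH, himm, ?_, ?_⟩
  · have : L ≤ k := by omega
    exact_mod_cast hU.trans (Nat.mul_le_mul_left _ this)
  · have h1 : k ^ 2 ≤ 2 * H.edgeSet.ncard := by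
      have : k * k ≤ (200000000000 * L) * (200000000000 * L) := Nat.mul_le_mul hkL hkL
      nlinarith
    have h2 : (k : ℝ) ^ 2 ≤ 2 * (H.edgeSet.ncard : ℝ) := by exact_mod_cast h1
    linarith
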